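/- **Theorem (marginal confidence set for $\beta_1$ in the partially permuted model).** *Setting.* Let $\mathcal P_n$ be the set of $n\times n$ permutation matrices, $d(\Pi,I_n)=\#\{i:\Pi_{ii}=0\}$ and $\mathcal P_{n,k}=\{\Pi\in\mathcal P_n: d(\Pi,I_n)\le k\}$. For a matrix $A$ with $n$ rows let $M_A$ be the orthogonal projector of $\mathbb R^n$ onto the range of $A$. Let $X\in\mathbb R^{n\times p_1}$ and $Z\in\mathbb R^{n\times p_2}$ be fixed, put $p=p_1+p_2$, and for $\Pi\in\mathcal P_n$ let $W(\Pi)=[\Pi X,\ Z]\in\mathbb R^{n\times p}$. Let $\Pi_0\in\mathcal P_{n,k}$, $\beta_1\in\mathbb R^{p_1}$, $\beta_2\in\mathbb R^{p_2}$ and $\sigma_0>0$ be the true parameters, and $$Y=\Pi_0X\beta_1+Z\beta_2+\sigma_0U,\qquad U\sim N(0,I_n).$$ Assume that $W(\Pi_0)$ has full column rank $p$, that $n>p+1$, and that $$C:=\min_{\Pi\in\mathcal P_{n,k},\ \Pi\ne\Pi_0}\frac{\|(I_n-M_{W(\Pi)})(\Pi_0X\beta_1+Z\beta_2)\|_2^2}{n\max\{d(\Pi_0,I_n)-d(\Pi,I_n),\,1\}}>0,$$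 where the minimum is understood to be over a non-empty set (that is, $k\ge2$). *Candidate set.* Let $L\ge2$ and let $U_1^*,\dots,U_L^*\sim N(0,I_n)$ be i.i.d. and independent of $U$. For each $\ell\le L$ let $\widehat\Pi_\ell$ be any minimizer over $\Pi\in\mathcal P_{n,k}$ of $\|(I_n-M_{(W(\Pi),U_\ell^*)})Y\|_2^2$, and let $\mathcal C^{(L)}=\{\widehat\Pi_\ell:\ell=1,\dots,L\}\subset\mathcal P_{n,k}$. *Confidence set.* For $\Pi\in\mathcal P_{n,k}$ and $\beta\in\mathbb R^{p_1}$, with $r=Y-\Pi X\beta$, let $$T(Y,(\Pi,\beta)\mid Z)=\frac{n-p}{p_1}\cdot\frac{r^\top(M_{W(\Pi)}-M_Z)\,r}{r^\top(I_n-M_{W(\Pi)})\,r},$$ let $F_{p_1,n-p}^{-1}$ be the quantile function of the $F$ distribution with $(p_1,n-p)$ degrees of freedom, and for $\alpha\in(0,1)$ let $$\Gamma_\alpha^{\rm partial}(Y)=\bigcup_{\Pi\in\mathcal C^{(L)}}\{\beta\in\mathbb R^{p_1}:\ T(Y,(\Pi,\beta)\mid Z)\le F^{-1}_{p_1,n-p}(\alpha)\}.$$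 *Error term.* Let $\Psi(x)=x-1-\log x$, let $D_m$ be the number of derangements of $m$ elements, and put $$\Delta(\gamma)=\sum_{m=n-\min(k,n)}^{n}\binom nm D_{n-m}\Big\{e^{-\frac n2\Psi\left(\max\{1,\frac{C\log(e/\gamma)}{2\sigma_0^2\gamma}\}\right)}+e^{-\frac n2\Psi\left(\max\{1,\frac{C\log^2(e/\gamma)}{16\sigma_0^2}\}\right)}\Big\}+\Big(\frac\pi2\Big)^{n-p-2}|\mathcal P_{n,k}|\Big(\gamma\log\frac e\gamma\Big)^{\frac{n-p-1}2},$$ $$\gamma_L=\min\Big\{\frac14,\Big(\frac{(n-1)\log(eL)}{L}\Big)^{\frac1{n-1}}\Big\},\qquad \delta_L^{\rm partial}=\Delta(\gamma_L)+\Big(1-\frac{\gamma_L^{n-1}}{n-1}\Big)^L.$$ *Claim.* For every $\alpha\in(0,1)$ and every $L\ge2$, under the joint law of $(U_1^*,\dots,U_L^*,U)$, $$\mathbb P\big(\beta_1\in\Gamma_\alpha^{\rm partial}(Y)\big)\ \ge\ \alpha-\delta_L^{\rm partial},$$ and, as $L\to\infty$ with all other quantities fixed, $$\delta_L^{\rm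 partial}=O\!\left(\frac{(\log L)^{(n-p)/2}}{L^{(n-p-1)/(2(n-1))}}\right).$$ -/

import Mathlib

open MeasureTheory ProbabilityTheory Filter Asymptotics

noncomputable section

namespace PartialPerm

/-- Hamming distance `d(Π, I_n) = ∑ i, 1{Π_{ii} = 0}` of the permutation matrix of `π` to the
identity: the diagonal entry of that matrix at `i` vanishes exactly when `π i ≠ i`. -/
def hammingId {n : ℕ} (π : Equiv.Perm (Fin n)) : ℕ :=
  (Finset.univ.filter fun i => π i ≠ i).card

/-- The set of `k`-sparse permutations. -/
def sparsePerms (n k : ℕ) : Finset (Equiv.Perm (Fin n)) :=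
  Finset.univ.filter fun π => hammingId π ≤ k

/-- The column space (range) of a matrix, as a subspace of Euclidean space. -/
def colSpace {n : ℕ} {ι : Type} [Fintype ι] [DecidableEq ι] (A : Matrix (Fin n) ι ℝ) :
    Submodule ℝ (EuclideanSpace ℝ (Fin n)) :=
  LinearMap.range (Matrix.toEuclideanLin A)

/-- `M_A`: the orthogonal projector onto the range of `A`. -/
def proj {n : ℕ} {ι : Type} [Fintype ι] [DecidableEq ι] (A : Matrix (Fin n) ι ℝ) :
    EuclideanSpace ℝ (Fin n) →L[ℝ] EuclideanSpace ℝ (Fin n) :=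
  (colSpace A).starProjection

/-- The permuted design `Π X`. -/
def permDesign {n p₁ : ℕ} (X : Matrix (Fin n) (Fin p₁) ℝ) (π : Equiv.Perm (Fin n)) :
    Matrix (Fin n) (Fin p₁) ℝ :=
  π.permMatrix ℝ * X

/-- The expanded design `W(Π) = [Π X, Z]`. -/
def expDesign {n p₁ p₂ : ℕ} (X : Matrix (Fin n) (Fin p₁) ℝ) (Z : Matrix (Fin n) (Fin p₂) ℝ)
    (π : Equiv.Perm (Fin n)) : Matrix (Fin n) (Fin p₁ ⊕ Fin p₂) ℝ :=
  Matrix.fromCols (permDesign X π) Z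

/-- The expanded design with one further column `u`, that is `(W(Π), u)`. -/
def augDesign {n p₁ p₂ : ℕ} (X : Matrix (Fin n) (Fin p₁) ℝ) (Z : Matrix (Fin n) (Fin p₂) ℝ)
    (π : Equiv.Perm (Fin n)) (u : EuclideanSpace ℝ (Fin n)) :
    Matrix (Fin n) ((Fin p₁ ⊕ Fin p₂) ⊕ Unit) ℝ :=
  Matrix.fromCols (expDesign X Z π) (Matrix.replicateCol Unit fun i => u i)

/-- The regression function `Π X β₁ + Z β₂`. -/
def signal {n p₁ p₂ : ℕ} (X : Matrix (Fin n) (Fin p₁) ℝ) (Z : Matrix (Fin n) (Fin p₂) ℝ)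
    (π : Equiv.Perm (Fin n)) (β₁ : EuclideanSpace ℝ (Fin p₁)) (β₂ : EuclideanSpace ℝ (Fin p₂)) :
    EuclideanSpace ℝ (Fin n) :=
  Matrix.toEuclideanLin (permDesign X π) β₁ + Matrix.toEuclideanLin Z β₂

/-- The response `Y = Π₀ X β₁ + Z β₂ + σ₀ u` of the partially permuted model with noise `u`. -/
def response {n p₁ p₂ : ℕ} (X : Matrix (Fin n) (Fin p₁) ℝ) (Z : Matrix (Fin n) (Fin p₂) ℝ)
    (π₀ : Equiv.Perm (Fin n)) (β₁ : EuclideanSpace ℝ (Fin p₁)) (β₂ : EuclideanSpace ℝ (Fin p₂))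
    (σ₀ : ℝ) (u : EuclideanSpace ℝ (Fin n)) : EuclideanSpace ℝ (Fin n) :=
  signal X Z π₀ β₁ β₂ + σ₀ • u

/-- The least squares objective `‖(I_n - M_{(W(Π), u)}) Y‖²` for the artificial noise `u`. -/
def reproObjective {n p₁ p₂ : ℕ} (X : Matrix (Fin n) (Fin p₁) ℝ) (Z : Matrix (Fin n) (Fin p₂) ℝ)
    (Y u : EuclideanSpace ℝ (Fin n)) (π : Equiv.Perm (Fin n)) : ℝ :=
  ‖Y - proj (augDesign X Z π u) Y‖ ^ 2

/-- `π̂` is a minimizer of the objective over the `k`-sparse permutations. -/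
def IsReproArgmin {n p₁ p₂ : ℕ} (k : ℕ) (X : Matrix (Fin n) (Fin p₁) ℝ)
    (Z : Matrix (Fin n) (Fin p₂) ℝ) (Y u : EuclideanSpace ℝ (Fin n))
    (πhat : Equiv.Perm (Fin n)) : Prop :=
  πhat ∈ sparsePerms n k ∧
    ∀ π ∈ sparsePerms n k, reproObjective X Z Y u πhat ≤ reproObjective X Z Y u π

/-- The candidate set collected from the estimates `π̂ 1, …, π̂ L`. -/
def candidateSet {n L : ℕ} (k : ℕ) (πhat : Fin L → Equiv.Perm (Fin n)) :
    Set (Equiv.Perm (Fin n)) :=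
  {π | π ∈ sparsePerms n k ∧ ∃ l, πhat l = π}

/-- The partialled-out statistic `T(Y, (Π, β₁) | Z)`. -/
def partialStat {n p₁ p₂ : ℕ} (X : Matrix (Fin n) (Fin p₁) ℝ) (Z : Matrix (Fin n) (Fin p₂) ℝ)
    (Y : EuclideanSpace ℝ (Fin n)) (π : Equiv.Perm (Fin n)) (β₁ : EuclideanSpace ℝ (Fin p₁)) :
    ℝ :=
  let r := Y - Matrix.toEuclideanLin (permDesign X π) β₁
  (((n : ℝ) - ((p₁ : ℝ) + (p₂ : ℝ))) / (p₁ : ℝ)) *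
    (inner ℝ r (proj (expDesign X Z π) r - proj Z r) /
      inner ℝ r (r - proj (expDesign X Z π) r))

/-- The `F` distribution with `(a, b)` degrees of freedom (`a, b ≥ 1`): the law of
`(‖G‖² / a) / (‖H‖² / b)` for independent standard Gaussian vectors `G` in dimension `a` and
`H` in dimension `b`. -/
def fDist (a b : ℕ) : Measure ℝ :=
  ((stdGaussian (EuclideanSpace ℝ (Fin a))).prod (stdGaussian (EuclideanSpace ℝ (Fin b)))).map
    fun z => (‖z.1‖ ^ 2 / (a : ℝ)) / (‖z.2‖ ^ 2 / (b : ℝ))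

/-- The quantile function `F_{a,b}⁻¹` of the `F` distribution. -/
def fQuantile (a b : ℕ) (α : ℝ) : ℝ :=
  sInf {x : ℝ | α ≤ cdf (fDist a b) x}

/-- The union confidence set for `β₁` over a candidate set `C`. -/
def confidenceSet {n p₁ p₂ : ℕ} (X : Matrix (Fin n) (Fin p₁) ℝ) (Z : Matrix (Fin n) (Fin p₂) ℝ)
    (α : ℝ) (C : Set (Equiv.Perm (Fin n))) (Y : EuclideanSpace ℝ (Fin n)) :
    Set (EuclideanSpace ℝ (Fin p₁)) :=
  ⋃ π ∈ C, {β₁ | partialStat X Z Y π β₁ ≤ fQuantile p₁ (n - (p₁ + p₂)) α}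

/-- The separation constant: the minimum over the `k`-sparse `Π ≠ Π₀` of
`‖(I_n - M_{W(Π)}) W(Π₀) (β₁, β₂)‖² / (n max{d(Π₀, I_n) - d(Π, I_n), 1})`.
There is at least one such `Π` whenever `k ≥ 2` and `n ≥ 2`; without one, the value
here is `0`, so that positivity of the constant includes that the minimum is not over an
empty set. -/
def sepConst {n p₁ p₂ : ℕ} (k : ℕ) (X : Matrix (Fin n) (Fin p₁) ℝ)
    (Z : Matrix (Fin n) (Fin p₂) ℝ) (π₀ : Equiv.Perm (Fin n))
    (β₁ : EuclideanSpace ℝ (Fin p₁)) (β₂ : EuclideanSpace ℝ (Fin p₂)) : ℝ :=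
  ⨅ π : {π : Equiv.Perm (Fin n) // π ∈ sparsePerms n k ∧ π ≠ π₀},
    ‖signal X Z π₀ β₁ β₂ - proj (expDesign X Z π.1) (signal X Z π₀ β₁ β₂)‖ ^ 2 /
      ((n : ℝ) * max ((hammingId π₀ : ℝ) - (hammingId π.1 : ℝ)) 1)

/-- `Ψ(x) = x - 1 - log x`. -/
def Psi (x : ℝ) : ℝ := x - 1 - Real.log x

/-- The function `Δ(γ)`, for sample size `n`, total number `p` of regressors, sparsity `k`,
separation constant `C` and noise level `σ₀`. -/
def Delta (n p k : ℕ) (C σ₀ γ : ℝ) : ℝ :=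
  (∑ m ∈ Finset.Icc (n - k) n, (n.choose m : ℝ) * (numDerangements (n - m) : ℝ) *
      (Real.exp (-((n : ℝ) / 2) *
          Psi (max 1 (C * Real.log (Real.exp 1 / γ) / (2 * σ₀ ^ 2 * γ)))) +
        Real.exp (-((n : ℝ) / 2) *
          Psi (max 1 (C * Real.log (Real.exp 1 / γ) ^ 2 / (16 * σ₀ ^ 2)))))) +
    (Real.pi / 2) ^ ((n : ℝ) - (p : ℝ) - 2) * ((sparsePerms n k).card : ℝ) *
      (γ * Real.log (Real.exp 1 / γ)) ^ (((n : ℝ) - (p : ℝ) - 1) / 2)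

/-- `γ_L = min{1/4, ((n-1) log(e L) / L)^{1/(n-1)}}`. -/
def gammaL (n L : ℕ) : ℝ :=
  min (1 / 4) ((((n : ℝ) - 1) * Real.log (Real.exp 1 * (L : ℝ)) / (L : ℝ)) ^
    (1 / ((n : ℝ) - 1)))

/-- `δ_L = Δ(γ_L) + (1 - γ_L^{n-1} / (n-1))^L`. -/
def deltaL (n p k : ℕ) (C σ₀ : ℝ) (L : ℕ) : ℝ :=
  Delta n p k C σ₀ (gammaL n L) + (1 - gammaL n L ^ (n - 1) / ((n : ℝ) - 1)) ^ L

end PartialPerm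

end

open PartialPerm

/-! At the true permutation the statistic is an exact pivot: `M_W - M_Z` and `I - M_W` project onto
orthogonal subspaces of dimensions `p₁` and `n - p` that both annihilate `Z β₂`, so the F law
follows (`stdGaussian_partialStat_le`). Coverage is then at least `α` minus the probability that the
candidate set misses `Π₀`, and it remains to bound that probability.

Suppose the artificial noise `u` makes an angle of sine at most `2γ` with the true noise `U`. Then
`W(Π₀)` augmented by `u` explains `Y` up to `2γσ₀‖U‖`. For `Π ≠ Π₀`, project to a subspace `V`
orthogonal to `W(Π)` that contains the part `w` of the signal missed by `Π`. Unless the projection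
of `u` is nearly parallel to `w` (squared sine at most `γ log(e/γ)`), the column `u` cannot absorb
`w`, and the wrong residual is strictly larger as long as `‖U‖` is not too large
(`residual_lt_residual`). A Chernoff bound controls `‖U‖`.

Both angle conditions describe Gaussian measures of double cones (`stdGaussian_cap`). A good
direction has probability `q ≥ γ^(n-1)/(n-1)` (`pow_div_le_capProb`). The exceptional set `B` of
directions, over all wrong `Π`, has measure at most the last term of `Δ` (`exists_exceptional_set`).
The samples all have to match the same `U`, yet `B` is paid for once rather than `L` times:
`measure_no_good_sample_le` gives `(1-q)^L + μ(B)`, by conditioning on `U`, convexity, and the fact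
that a vector near `U` is, on average over `U`, distributed like `u` itself.

For the rate, `γ_L` makes the miss probability eventually at most `1/(eL)`; the exponential tails
are also `O(1/L)`, so the cap term decides. -/

namespace PartialPerm

open Module
open scoped RealInnerProductSpace ENNReal NNReal

/-! ### Density and norm tails of the standard Gaussian measure. -/

section Gaussian

variable {E : Type*} [NormedAddCommGroup E] [InnerProductSpace ℝ E] [FiniteDimensional ℝ E]
  [MeasurableSpace E] [BorelSpace E]

/-- The density of the standard Gaussian distribution with respect to the volume. -/
noncomputable def stdGaussianPDF (E : Type*) [NormedAddCommGroup E] [InnerProductSpace ℝ E]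
    (x : E) : ℝ :=
  (2 * Real.pi) ^ (-(finrank ℝ E : ℝ) / 2) * Real.exp (-(1 / 2) * ‖x‖ ^ 2)

omit [FiniteDimensional ℝ E] [MeasurableSpace E] [BorelSpace E] in
lemma stdGaussianPDF_nonneg (x : E) : 0 ≤ stdGaussianPDF E x := by
  unfold stdGaussianPDF; positivity

omit [FiniteDimensional ℝ E] [MeasurableSpace E] [BorelSpace E] in
lemma continuous_stdGaussianPDF : Continuous (stdGaussianPDF E) := by
  unfold stdGaussianPDF; fun_prop

omit [FiniteDimensional ℝ E] in
lemma measurable_ofReal_stdGaussianPDF :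
    Measurable fun x : E => ENNReal.ofReal (stdGaussianPDF E x) :=
  ENNReal.measurable_ofReal.comp continuous_stdGaussianPDF.measurable

lemma integrable_exp_neg_mul_sq_norm {b : ℝ} (hb : 0 < b) :
    Integrable (fun x : E => Real.exp (-b * ‖x‖ ^ 2)) := by
  refine Integrable.of_integral_ne_zero ?_
  rw [GaussianFourier.integral_rexp_neg_mul_sq_norm hb]
  positivity

/-- The moment generating function of the squared norm: `s = 0` normalizes the density, and positive
`s` drives the Chernoff bound. -/
lemma integral_stdGaussianPDF_mul_exp {s : ℝ} (hs : s < 1 / 2) :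
    ∫ x : E, stdGaussianPDF E x * Real.exp (s * ‖x‖ ^ 2) =
      (1 - 2 * s) ^ (-(finrank ℝ E : ℝ) / 2) := by
  have h : ∀ x : E, stdGaussianPDF E x * Real.exp (s * ‖x‖ ^ 2) =
      (2 * Real.pi) ^ (-(finrank ℝ E : ℝ) / 2) * Real.exp (-(1 / 2 - s) * ‖x‖ ^ 2) := by
    intro x
    rw [stdGaussianPDF, mul_assoc, ← Real.exp_add]
    ring_nf
  simp_rw [h]
  rw [integral_const_mul, GaussianFourier.integral_rexp_neg_mul_sq_norm (by linarith),
    show Real.pi / (1 / 2 - s) = (2 * Real.pi) * (1 - 2 * s)⁻¹ by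
      have : 1 - 2 * s ≠ 0 := by linarith
      have : 1 / 2 - s ≠ 0 := by linarith
      field_simp,
    Real.mul_rpow (by positivity) (inv_nonneg.2 (by linarith)), ← mul_assoc,
    ← Real.rpow_add (by positivity), Real.inv_rpow (by linarith), ← Real.rpow_neg (by linarith)]
  rw [show -(finrank ℝ E : ℝ) / 2 + (finrank ℝ E : ℝ) / 2 = 0 by ring, Real.rpow_zero, one_mul,
    neg_div]

lemma integrable_stdGaussianPDF : Integrable (stdGaussianPDF E) :=
  (integrable_exp_neg_mul_sq_norm (by norm_num)).const_mul _

/-- The two characteristic functions agree. The density form is what makes probabilities of small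
balls computable. -/
lemma stdGaussian_eq_withDensity :
    stdGaussian E = volume.withDensity fun x => ENNReal.ofReal (stdGaussianPDF E x) := by
  have h1 : ∫⁻ x : E, ENNReal.ofReal (stdGaussianPDF E x) = 1 := by
    rw [← ofReal_integral_eq_lintegral_ofReal integrable_stdGaussianPDF
      (ae_of_all _ stdGaussianPDF_nonneg)]
    simpa using integral_stdGaussianPDF_mul_exp (E := E) (s := 0) (by norm_num)
  have : IsFiniteMeasure (volume.withDensity fun x : E => ENNReal.ofReal (stdGaussianPDF E x)) :=
    isFiniteMeasure_withDensity (by simp [h1])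
  refine Measure.ext_of_charFun (funext fun t => ?_)
  rw [charFun_stdGaussian, charFun_apply,
    integral_withDensity_eq_integral_toReal_smul
      measurable_ofReal_stdGaussianPDF
      (ae_of_all _ fun _ => ENNReal.ofReal_lt_top)]
  have h2 : ∀ x : E, (ENNReal.ofReal (stdGaussianPDF E x)).toReal •
      Complex.exp (⟪x, t⟫ * Complex.I) = ((2 * Real.pi : ℝ) : ℂ) ^ (-(finrank ℝ E : ℂ) / 2) *
        Complex.exp (-(1 / 2 : ℂ) * ‖x‖ ^ 2 + Complex.I * ⟪t, x⟫) := by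
    intro x
    rw [ENNReal.toReal_ofReal (stdGaussianPDF_nonneg x), stdGaussianPDF, Complex.real_smul,
      Complex.ofReal_mul, Complex.ofReal_cpow (by positivity), Complex.exp_add, real_inner_comm x t]
    push_cast
    ring_nf
  simp_rw [h2]
  rw [integral_const_mul, GaussianFourier.integral_cexp_neg_mul_sq_norm_add (by norm_num),
    ← mul_assoc]
  have h3 : (Real.pi / (1 / 2 : ℂ)) = ((2 * Real.pi : ℝ) : ℂ) := by push_cast; ring
  have hne : ((2 * Real.pi : ℝ) : ℂ) ≠ 0 := by
    exact_mod_cast (by positivity : (2 * Real.pi : ℝ) ≠ 0)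
  rw [h3, ← Complex.cpow_add _ _ hne, Complex.I_sq,
    show -(finrank ℝ E : ℂ) / 2 + (finrank ℝ E : ℂ) / 2 = 0 by ring, Complex.cpow_zero, one_mul]
  congr 1
  ring

lemma lintegral_stdGaussian {f : E → ℝ≥0∞} (hf : Measurable f) :
    ∫⁻ x, f x ∂stdGaussian E = ∫⁻ x, ENNReal.ofReal (stdGaussianPDF E x) * f x := by
  rw [stdGaussian_eq_withDensity, lintegral_withDensity_eq_lintegral_mul _
    measurable_ofReal_stdGaussianPDF hf]
  rfl

lemma stdGaussian_singleton [Nontrivial E] (x : E) : stdGaussian E {x} = 0 := by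
  rw [stdGaussian_eq_withDensity]
  exact withDensity_absolutelyContinuous _ _ (measure_singleton x)

/-- Chernoff bound for the squared norm of a standard Gaussian vector. -/
lemma stdGaussian_norm_sq_ge_le {x : ℝ} (hx : 1 ≤ x) :
    (stdGaussian E).real {u | (finrank ℝ E : ℝ) * x ≤ ‖u‖ ^ 2} ≤
      Real.exp (-((finrank ℝ E : ℝ) / 2) * Psi x) := by
  set N : ℝ := (finrank ℝ E : ℝ)
  have hx0 : 0 < x := by linarith
  -- The optimal Chernoff parameter, for which `1 - 2s = 1/x`.
  set s : ℝ := (1 - 1 / x) / 2 with hs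
  have hs0 : 0 ≤ s := by
    have : 1 / x ≤ 1 := by rw [div_le_one hx0]; exact hx
    rw [hs]; linarith
  have hs1 : s < 1 / 2 := by
    have : 0 < 1 / x := by positivity
    rw [hs]; linarith
  have hmeas : Measurable fun u : E => ENNReal.ofReal (Real.exp (s * ‖u‖ ^ 2)) := by fun_prop
  have hint : Integrable fun u : E => stdGaussianPDF E u * Real.exp (s * ‖u‖ ^ 2) := by
    refine Integrable.of_integral_ne_zero ?_
    rw [integral_stdGaussianPDF_mul_exp hs1]
    have : 0 < 1 - 2 * s := by linarith
    positivity
  have hl : ∫⁻ u, ENNReal.ofReal (Real.exp (s * ‖u‖ ^ 2)) ∂stdGaussian E =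
      ENNReal.ofReal (x ^ (N / 2)) := by
    rw [lintegral_stdGaussian hmeas]
    simp_rw [← ENNReal.ofReal_mul (stdGaussianPDF_nonneg _)]
    rw [← ofReal_integral_eq_lintegral_ofReal hint
      (ae_of_all _ fun u => mul_nonneg (stdGaussianPDF_nonneg u) (Real.exp_nonneg _)),
      integral_stdGaussianPDF_mul_exp hs1, show 1 - 2 * s = x⁻¹ by rw [hs]; field_simp; ring,
      Real.inv_rpow hx0.le, neg_div, Real.rpow_neg hx0.le, inv_inv]
  have hm := mul_meas_ge_le_lintegral₀ (μ := stdGaussian E) hmeas.aemeasurable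
    (ENNReal.ofReal (Real.exp (s * (N * x))))
  rw [hl] at hm
  have hsub : {u : E | N * x ≤ ‖u‖ ^ 2} ⊆
      {u | ENNReal.ofReal (Real.exp (s * (N * x))) ≤ ENNReal.ofReal (Real.exp (s * ‖u‖ ^ 2))} := by
    intro u hu
    exact ENNReal.ofReal_le_ofReal (Real.exp_le_exp.2 (mul_le_mul_of_nonneg_left hu hs0))
  have h2 := (mul_le_mul_right (measure_mono hsub) _).trans hm
  rw [← ofReal_measureReal, ← ENNReal.ofReal_mul (Real.exp_nonneg _),
    ENNReal.ofReal_le_ofReal_iff (by positivity)] at h2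
  rw [Real.rpow_def_of_pos hx0] at h2
  have h3 : (stdGaussian E).real {u | N * x ≤ ‖u‖ ^ 2} ≤
      Real.exp (Real.log x * (N / 2)) / Real.exp (s * (N * x)) := by
    rw [le_div_iff₀ (Real.exp_pos _), mul_comm]; exact h2
  rw [← Real.exp_sub] at h3
  refine h3.trans (le_of_eq ?_)
  congr 1
  rw [hs, Psi]
  field_simp
  ring

end Gaussian

/-! ### Independence of orthogonal Gaussian projections. -/

section Projections

variable {E : Type*} [NormedAddCommGroup E] [InnerProductSpace ℝ E] [FiniteDimensional ℝ E]
  [MeasurableSpace E] [BorelSpace E]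

/-- Projections of a standard Gaussian vector onto orthogonal subspaces are independent and
standard Gaussian. -/
lemma stdGaussian_map_orthogonalProjection_pair (V W : Submodule ℝ E) (h : V ⟂ W) :
    (stdGaussian E).map (fun x => (V.orthogonalProjectionOnto x, W.orthogonalProjectionOnto x)) =
      (stdGaussian V).prod (stdGaussian W) := by
  have hm : Measurable fun x : E => (V.orthogonalProjectionOnto x, W.orthogonalProjectionOnto x) := by
    fun_prop
  have := Measure.isProbabilityMeasure_map (μ := stdGaussian E) hm.aemeasurable
  refine charFun_eq_prod_iff.1 fun t => ?_
  rw [charFun_stdGaussian, charFun_stdGaussian, ← Complex.exp_add, charFun_apply,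
    integral_map (by fun_prop) (by fun_prop), integral_map hm.aemeasurable (by fun_prop)]
  -- Projections are self-adjoint, so the pair's characteristic function at `t` is that of `x` at
  -- the sum of the two components; Pythagoras then factors it.
  have h1 : ∀ x : E, ⟪WithLp.toLp 2 (V.orthogonalProjectionOnto x, W.orthogonalProjectionOnto x), t⟫ =
      ⟪x, (t.fst : E) + (t.snd : E)⟫ := by
    intro x
    rw [WithLp.prod_inner_apply, inner_add_right]
    congr 1
    · exact Submodule.inner_orthogonalProjectionOnto_eq_of_mem_right t.fst x
    · exact Submodule.inner_orthogonalProjectionOnto_eq_of_mem_right t.snd x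
  simp_rw [h1]
  rw [← charFun_apply, charFun_stdGaussian]
  congr 1
  have h2 : ‖(t.fst : E) + (t.snd : E)‖ ^ 2 = ‖t.fst‖ ^ 2 + ‖t.snd‖ ^ 2 := by
    rw [norm_add_sq_real, h.inner_eq t.fst.2 t.snd.2]
    simp
  have h3 : ((‖(t.fst : E) + (t.snd : E)‖ : ℂ)) ^ 2 = (‖t.fst‖ : ℂ) ^ 2 + (‖t.snd‖ : ℂ) ^ 2 := by
    exact_mod_cast h2
  rw [h3]
  change _ = -(‖t.fst‖ : ℂ) ^ 2 / 2 + -(‖t.snd‖ : ℂ) ^ 2 / 2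
  ring

lemma map_norm_stdGaussian {a : ℕ} (ha : finrank ℝ E = a) :
    (stdGaussian E).map norm = (stdGaussian (EuclideanSpace ℝ (Fin a))).map norm := by
  subst ha
  rw [← stdGaussian_map (stdOrthonormalBasis ℝ E).repr, Measure.map_map (by fun_prop) (by fun_prop)]
  congr 1
  ext x
  simp

/-- The joint law of the norms of two orthogonal projections of a standard Gaussian vector. -/
lemma stdGaussian_map_norm_pair {V W : Submodule ℝ E} (h : V ⟂ W) {a b : ℕ}
    (ha : finrank ℝ V = a) (hb : finrank ℝ W = b) :
    (stdGaussian E).map (fun x => (‖V.starProjection x‖, ‖W.starProjection x‖)) =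
      ((stdGaussian (EuclideanSpace ℝ (Fin a))).prod (stdGaussian (EuclideanSpace ℝ (Fin b)))).map
        (fun z => (‖z.1‖, ‖z.2‖)) := by
  have h1 : (fun x : E => (‖V.starProjection x‖, ‖W.starProjection x‖)) =
      Prod.map norm norm ∘ fun x => (V.orthogonalProjectionOnto x, W.orthogonalProjectionOnto x) := by
    rfl
  rw [h1, ← Measure.map_map (by fun_prop) (by fun_prop),
    stdGaussian_map_orthogonalProjection_pair V W h,
    ← Measure.map_prod_map _ _ measurable_norm measurable_norm, map_norm_stdGaussian ha,
    map_norm_stdGaussian hb, Measure.map_prod_map _ _ measurable_norm measurable_norm]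
  rfl

end Projections

/-! ### The leading constant of the cap probability. -/

section Caps

/-- The probability that a standard Gaussian vector in dimension `m + 1` makes an angle with
squared sine at most `x` with a fixed line. -/
noncomputable def capProb (m : ℕ) (x : ℝ) : ℝ≥0∞ :=
  ((stdGaussian (EuclideanSpace ℝ (Fin 1))).prod (stdGaussian (EuclideanSpace ℝ (Fin m))))
    {z | (1 - x) * ‖z.2‖ ^ 2 ≤ x * ‖z.1‖ ^ 2}

/-- The leading constant of `capProb m x` as `x` tends to zero. -/
noncomputable def capConst (m : ℕ) : ℝ :=
  Real.Gamma (((m : ℝ) + 1) / 2) / (√Real.pi * Real.Gamma ((m : ℝ) / 2 + 1))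

lemma capConst_one : capConst 1 = 2 / Real.pi := by
  have h : Real.Gamma ((1 : ℝ) / 2 + 1) = √Real.pi / 2 := by
    rw [Real.Gamma_add_one (by norm_num), Real.Gamma_one_half_eq]; ring
  have h2 : √Real.pi * √Real.pi = Real.pi := Real.mul_self_sqrt Real.pi_pos.le
  rw [capConst, show (((1 : ℕ) : ℝ) + 1) / 2 = 1 by norm_num, Nat.cast_one, h, Real.Gamma_one,
    ← mul_div_assoc, h2]
  field_simp

lemma capConst_two : capConst 2 = 1 / 2 := by
  have h : Real.Gamma ((1 : ℝ) / 2 + 1) = √Real.pi / 2 := by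
    rw [Real.Gamma_add_one (by norm_num), Real.Gamma_one_half_eq]; ring
  have h2 : Real.Gamma ((1 : ℝ) + 1) = 1 := by
    rw [Real.Gamma_add_one (by norm_num), Real.Gamma_one]; norm_num
  have h3 : √Real.pi ≠ 0 := by positivity
  rw [capConst, show (((2 : ℕ) : ℝ) + 1) / 2 = 1 / 2 + 1 by norm_num, h,
    show ((2 : ℕ) : ℝ) / 2 + 1 = 1 + 1 by norm_num, h2]
  field_simp

/-- Two-step recursion: with the explicit values at 1 and 2 it yields both bounds on the constant by
induction. -/
lemma capConst_add_two (m : ℕ) :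
    capConst (m + 2) = capConst m * (((m : ℝ) + 1) / ((m : ℝ) + 2)) := by
  have h1 : Real.Gamma ((((m + 2 : ℕ) : ℝ) + 1) / 2) =
      (((m : ℝ) + 1) / 2) * Real.Gamma (((m : ℝ) + 1) / 2) := by
    rw [← Real.Gamma_add_one (by positivity)]
    congr 1; push_cast; ring
  have h2 : Real.Gamma (((m + 2 : ℕ) : ℝ) / 2 + 1) =
      ((m : ℝ) / 2 + 1) * Real.Gamma ((m : ℝ) / 2 + 1) := by
    rw [← Real.Gamma_add_one (by positivity)]
    congr 1; push_cast; ring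
  have h3 : √Real.pi ≠ 0 := by positivity
  have h4 : Real.Gamma ((m : ℝ) / 2 + 1) ≠ 0 := (Real.Gamma_pos_of_pos (by positivity)).ne'
  rw [capConst, capConst, h1, h2]
  field_simp

lemma capConst_pos (m : ℕ) : 0 < capConst m :=
  div_pos (Real.Gamma_pos_of_pos (by positivity))
    (mul_pos (by positivity) (Real.Gamma_pos_of_pos (by positivity)))

lemma capConst_le : ∀ m : ℕ, 1 ≤ m → capConst m ≤ 2 / Real.pi
  | 0, h => absurd h (by norm_num)
  | 1, _ => capConst_one.le
  | 2, _ => by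
    rw [capConst_two, div_le_div_iff₀ (by norm_num) Real.pi_pos]
    linarith [Real.pi_le_four]
  | m + 3, _ => by
    rw [show m + 3 = (m + 1) + 2 by ring, capConst_add_two]
    refine (mul_le_of_le_one_right (capConst_pos _).le ?_).trans
      (capConst_le (m + 1) (by omega))
    rw [div_le_one (by positivity)]
    linarith

lemma le_capConst : ∀ m : ℕ, 1 ≤ m → 1 / ((m : ℝ) + 1) ≤ capConst m
  | 0, h => absurd h (by norm_num)
  | 1, _ => by
    rw [capConst_one, div_le_div_iff₀ (by norm_num) Real.pi_pos]
    norm_num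
    linarith [Real.pi_le_four]
  | 2, _ => by rw [capConst_two]; norm_num
  | m + 3, _ => by
    rw [show m + 3 = (m + 1) + 2 by ring, capConst_add_two]
    refine le_trans ?_ (mul_le_mul_of_nonneg_right
      (le_capConst (m + 1) (by omega)) (by positivity))
    push_cast
    rw [div_mul_div_comm, div_le_div_iff₀ (by positivity) (by positivity)]
    nlinarith [(Nat.cast_nonneg m : (0 : ℝ) ≤ m)]

end Caps

/-! ### Two-sided estimates of the cap probability. -/

section Caps

lemma rpow_neg_natCast_div_two {y : ℝ} (hy : 0 < y) (m : ℕ) :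
    y ^ (-(m : ℝ) / 2) = (√y ^ m)⁻¹ := by
  rw [neg_div, Real.rpow_neg hy.le, Real.sqrt_eq_rpow, ← Real.rpow_natCast, ← Real.rpow_mul hy.le]
  congr 2
  ring

/-- The density at zero of the standard Gaussian distribution in dimension `m`, times the volume
of the unit ball. -/
noncomputable def gaussianBallConst (m : ℕ) : ℝ :=
  (√2 ^ m)⁻¹ / Real.Gamma ((m : ℝ) / 2 + 1)

lemma gaussianBallConst_nonneg (m : ℕ) : 0 ≤ gaussianBallConst m :=
  div_nonneg (by positivity) (Real.Gamma_pos_of_pos (by positivity)).le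

lemma volume_closedBall_mul_pdf_zero {m : ℕ} (hm : 1 ≤ m) {r : ℝ} (hr : 0 ≤ r) :
    ENNReal.ofReal ((2 * Real.pi) ^ (-(m : ℝ) / 2)) *
      volume (Metric.closedBall (0 : EuclideanSpace ℝ (Fin m)) r) =
        ENNReal.ofReal (gaussianBallConst m * r ^ m) := by
  have : Nonempty (Fin m) := ⟨⟨0, hm⟩⟩
  rw [EuclideanSpace.volume_closedBall, Fintype.card_fin, ← ENNReal.ofReal_pow hr,
    ← ENNReal.ofReal_mul (by positivity), ← ENNReal.ofReal_mul (by positivity),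
    rpow_neg_natCast_div_two (by positivity), gaussianBallConst,
    Real.sqrt_mul (by norm_num), mul_pow]
  congr 1
  have : √Real.pi ≠ 0 := by positivity
  field_simp

/-- The density is largest at the centre; the matching lower bound below uses its smallest value,
attained on the boundary of the ball. -/
lemma stdGaussian_closedBall_le {m : ℕ} (hm : 1 ≤ m) {r : ℝ} (hr : 0 ≤ r) :
    stdGaussian (EuclideanSpace ℝ (Fin m)) (Metric.closedBall 0 r) ≤
      ENNReal.ofReal (gaussianBallConst m * r ^ m) := by
  rw [← volume_closedBall_mul_pdf_zero hm hr, stdGaussian_eq_withDensity,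
    withDensity_apply _ Metric.isClosed_closedBall.measurableSet, ← setLIntegral_const]
  refine lintegral_mono fun y => ENNReal.ofReal_le_ofReal ?_
  rw [stdGaussianPDF, finrank_euclideanSpace_fin]
  refine mul_le_of_le_one_right (by positivity) (Real.exp_le_one_iff.2 ?_)
  nlinarith [sq_nonneg ‖y‖]

lemma le_stdGaussian_closedBall {m : ℕ} (hm : 1 ≤ m) {r : ℝ} (hr : 0 ≤ r) :
    ENNReal.ofReal (gaussianBallConst m * r ^ m * Real.exp (-(1 / 2) * r ^ 2)) ≤
      stdGaussian (EuclideanSpace ℝ (Fin m)) (Metric.closedBall 0 r) := by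
  rw [ENNReal.ofReal_mul (mul_nonneg (gaussianBallConst_nonneg m) (by positivity)),
    ← volume_closedBall_mul_pdf_zero hm hr, mul_right_comm, ← ENNReal.ofReal_mul (by positivity),
    stdGaussian_eq_withDensity,
    withDensity_apply _ Metric.isClosed_closedBall.measurableSet, ← setLIntegral_const]
  refine setLIntegral_mono measurable_ofReal_stdGaussianPDF
    fun y hy => ENNReal.ofReal_le_ofReal ?_
  rw [stdGaussianPDF, finrank_euclideanSpace_fin]
  refine mul_le_mul_of_nonneg_left (Real.exp_le_exp.2 ?_) (by positivity)
  have : ‖y‖ ≤ r := by simpa using hy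
  have := pow_le_pow_left₀ (norm_nonneg y) this 2
  linarith

/-- Absolute moments of a one-dimensional standard Gaussian vector, with exponential weight. -/
lemma lintegral_norm_pow_mul_exp (m : ℕ) {s : ℝ} (hs : 0 ≤ s) :
    ∫⁻ a, ENNReal.ofReal (‖a‖ ^ m * Real.exp (-s * ‖a‖ ^ 2))
        ∂stdGaussian (EuclideanSpace ℝ (Fin 1)) =
      ENNReal.ofReal ((√Real.pi)⁻¹ * √2 ^ m * (√(1 + 2 * s) ^ (m + 1))⁻¹ *
        Real.Gamma (((m : ℝ) + 1) / 2)) := by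
  have hc : 0 < 1 / 2 + s := by linarith
  have hG : 0 < Real.Gamma (((m : ℝ) + 1) / 2) := Real.Gamma_pos_of_pos (by positivity)
  have hvol : (volume : Measure (EuclideanSpace ℝ (Fin 1))).real (Metric.ball 0 1) = 2 := by
    rw [Measure.real, EuclideanSpace.volume_ball]
    have h : Real.Gamma ((1 : ℝ) / 2 + 1) = √Real.pi / 2 := by
      rw [Real.Gamma_add_one (by norm_num), Real.Gamma_one_half_eq]; ring
    have h3 : √Real.pi ≠ 0 := by positivity
    simp only [Fintype.card_fin, Nat.cast_one, h, pow_one, ENNReal.ofReal_one, one_mul]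
    rw [ENNReal.toReal_ofReal (by positivity)]
    field_simp
  have hI : ∫ a : EuclideanSpace ℝ (Fin 1), stdGaussianPDF _ a *
      (‖a‖ ^ m * Real.exp (-s * ‖a‖ ^ 2)) = (√Real.pi)⁻¹ * √2 ^ m * (√(1 + 2 * s) ^ (m + 1))⁻¹ *
        Real.Gamma (((m : ℝ) + 1) / 2) := by
    have h1 : ∀ a : EuclideanSpace ℝ (Fin 1), stdGaussianPDF _ a *
        (‖a‖ ^ m * Real.exp (-s * ‖a‖ ^ 2)) =
          (√(2 * Real.pi))⁻¹ * (‖a‖ ^ (m : ℝ) * Real.exp (-(1 / 2 + s) * ‖a‖ ^ (2 : ℝ))) := by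
      intro a
      have h2 : (2 * Real.pi) ^ (-(1 : ℝ) / 2) = (√(2 * Real.pi))⁻¹ := by
        simpa using rpow_neg_natCast_div_two (y := 2 * Real.pi) (by positivity) 1
      rw [stdGaussianPDF, finrank_euclideanSpace_fin, Nat.cast_one, h2, Real.rpow_natCast,
        Real.rpow_two, neg_add, add_mul, Real.exp_add]
      ring
    simp_rw [h1]
    rw [integral_const_mul, integral_fun_norm_addHaar volume
      (fun y : ℝ => y ^ (m : ℝ) * Real.exp (-(1 / 2 + s) * y ^ (2 : ℝ))), hvol]
    simp only [finrank_euclideanSpace_fin, Nat.sub_self, pow_zero, one_smul, smul_eq_mul, one_mul]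
    rw [integral_rpow_mul_exp_neg_mul_rpow (p := 2) (by norm_num)
      (by have : (0 : ℝ) ≤ m := Nat.cast_nonneg m
          linarith) hc]
    have h4 := rpow_neg_natCast_div_two hc (m + 1)
    push_cast at h4
    rw [h4, show 1 / 2 + s = (1 + 2 * s) / 2 by ring, Real.sqrt_div (by linarith),
      Real.sqrt_mul (by norm_num), div_pow, inv_div]
    have h5 : √(1 + 2 * s) ≠ 0 := by
      have : 0 < 1 + 2 * s := by linarith
      positivity
    have h6 : √Real.pi ≠ 0 := by positivity
    have h7 : √(2 : ℝ) ≠ 0 := by positivity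
    field_simp
    ring
  have hint : Integrable fun a : EuclideanSpace ℝ (Fin 1) => stdGaussianPDF _ a *
      (‖a‖ ^ m * Real.exp (-s * ‖a‖ ^ 2)) := by
    refine Integrable.of_integral_ne_zero ?_
    have : 0 < 1 + 2 * s := by linarith
    rw [hI]
    positivity
  rw [lintegral_stdGaussian (by fun_prop)]
  simp_rw [← ENNReal.ofReal_mul (stdGaussianPDF_nonneg _)]
  rw [← ofReal_integral_eq_lintegral_ofReal hint
    (ae_of_all _ fun a => mul_nonneg (stdGaussianPDF_nonneg a) (by positivity)), hI]

/-- Tonelli: for a fixed coordinate `a` along the axis, the slice of the cone is a ball of radius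
`|a|` times the tangent of the opening angle. -/
lemma capProb_eq_lintegral (m : ℕ) {x : ℝ} (hx0 : 0 ≤ x) (hx1 : x < 1) :
    capProb m x = ∫⁻ a, stdGaussian (EuclideanSpace ℝ (Fin m))
      (Metric.closedBall 0 (√(x / (1 - x)) * ‖a‖)) ∂stdGaussian (EuclideanSpace ℝ (Fin 1)) := by
  have h1x : 0 < 1 - x := by linarith
  rw [capProb, Measure.prod_apply (measurableSet_le (by fun_prop) (by fun_prop))]
  refine lintegral_congr fun a => ?_
  congr 1
  ext b
  simp only [Set.mem_preimage, Set.mem_ofPred_eq, mem_closedBall_zero_iff]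
  rw [← sq_le_sq₀ (norm_nonneg b) (by positivity), mul_pow,
    Real.sq_sqrt (div_nonneg hx0 h1x.le), div_mul_eq_mul_div, le_div_iff₀ h1x, mul_comm]

lemma gaussianBallConst_mul (m : ℕ) :
    gaussianBallConst m * ((√Real.pi)⁻¹ * √2 ^ m * Real.Gamma (((m : ℝ) + 1) / 2)) =
      capConst m := by
  have h4 : Real.Gamma ((m : ℝ) / 2 + 1) ≠ 0 := (Real.Gamma_pos_of_pos (by positivity)).ne'
  rw [gaussianBallConst, capConst]
  field_simp

lemma capProb_le {m : ℕ} (hm : 1 ≤ m) {x : ℝ} (hx0 : 0 ≤ x) (hx1 : x < 1) :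
    capProb m x ≤ ENNReal.ofReal (capConst m * √(x / (1 - x)) ^ m) := by
  rw [capProb_eq_lintegral m hx0 hx1]
  set T := √(x / (1 - x))
  have hK := gaussianBallConst_nonneg m
  calc _ ≤ ∫⁻ a, ENNReal.ofReal (gaussianBallConst m * T ^ m) *
        ENNReal.ofReal (‖a‖ ^ m * Real.exp (-0 * ‖a‖ ^ 2))
          ∂stdGaussian (EuclideanSpace ℝ (Fin 1)) := by
        refine lintegral_mono fun a => (stdGaussian_closedBall_le hm (by positivity)).trans_eq ?_
        rw [← ENNReal.ofReal_mul (by positivity)]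
        congr 1
        simp only [neg_zero, zero_mul, Real.exp_zero]
        ring
    _ = _ := by
        rw [lintegral_const_mul _ (by fun_prop), lintegral_norm_pow_mul_exp m le_rfl,
          ← ENNReal.ofReal_mul (by positivity), ← gaussianBallConst_mul]
        congr 1
        simp
        ring

lemma le_capProb {m : ℕ} (hm : 1 ≤ m) {x : ℝ} (hx0 : 0 ≤ x) (hx1 : x < 1) :
    ENNReal.ofReal (capConst m * √x ^ m * √(1 - x)) ≤ capProb m x := by
  have h1x : 0 < 1 - x := by linarith
  rw [capProb_eq_lintegral m hx0 hx1]
  set T := √(x / (1 - x)) with hT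
  have hT2 : T ^ 2 = x / (1 - x) := Real.sq_sqrt (div_nonneg hx0 h1x.le)
  have hK := gaussianBallConst_nonneg m
  calc _ = ∫⁻ a, ENNReal.ofReal (gaussianBallConst m * T ^ m) *
        ENNReal.ofReal (‖a‖ ^ m * Real.exp (-(T ^ 2 / 2) * ‖a‖ ^ 2))
          ∂stdGaussian (EuclideanSpace ℝ (Fin 1)) := by
        rw [lintegral_const_mul _ (by fun_prop), lintegral_norm_pow_mul_exp m (by positivity),
          ← ENNReal.ofReal_mul (by positivity), ← gaussianBallConst_mul]
        congr 1
        -- Since `1 + tan² = 1/cos²`, the weighted moment contributes `cos^(m+1)`, which turns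
        -- `tan^m` into `sin^m` times one cosine.
        have h2 : 1 + 2 * (T ^ 2 / 2) = (1 - x)⁻¹ := by rw [hT2]; field_simp; ring
        have h3 : √(1 - x) ≠ 0 := by positivity
        rw [h2, Real.sqrt_inv, hT, Real.sqrt_div hx0, inv_pow, inv_inv, div_pow, pow_succ]
        field_simp
    _ ≤ _ := by
        refine lintegral_mono fun a => le_trans (le_of_eq ?_)
          (le_stdGaussian_closedBall hm (by positivity))
        rw [← ENNReal.ofReal_mul (by positivity)]
        congr 1
        ring_nf

end Caps

/-! ### Gaussian measure of double cones. -/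

section CapMeasure

variable {E : Type*} [NormedAddCommGroup E] [InnerProductSpace ℝ E] [FiniteDimensional ℝ E]

omit [FiniteDimensional ℝ E] in
lemma norm_sq_starProjection_span_singleton_mul (w u : E) :
    ‖(ℝ ∙ w).starProjection u‖ ^ 2 * ‖w‖ ^ 2 = ⟪u, w⟫ ^ 2 := by
  rcases eq_or_ne w 0 with rfl | hw
  · simp
  have : ‖w‖ ≠ 0 := norm_ne_zero_iff.2 hw
  rw [Submodule.starProjection_singleton, norm_smul, mul_pow, Real.norm_eq_abs, sq_abs,
    real_inner_comm]
  simp only [RCLike.ofReal_real_eq_id, id_eq]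
  field_simp

/-- Used twice: to split off the axis of a cone, and to recognize `M_W - M_Z` as a projector. -/
lemma starProjection_eq_add_of_le {V₁ V : Submodule ℝ E} (h : V₁ ≤ V) (u : E) :
    V.starProjection u = V₁.starProjection u + (V₁ᗮ ⊓ V).starProjection u := by
  have hp₁ : ∀ y, V₁.starProjection y ∈ V₁ := Submodule.starProjection_apply_mem _
  have hp₂ : ∀ y, (V₁ᗮ ⊓ V).starProjection y ∈ V₁ᗮ ⊓ V := Submodule.starProjection_apply_mem _
  refine Submodule.eq_starProjection_of_mem_orthogonal
    (V.add_mem (h (hp₁ u)) (hp₂ u).2) ((Submodule.mem_orthogonal _ _).2 fun y hy => ?_)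
  have hy₂ : y - V₁.starProjection y ∈ V₁ᗮ ⊓ V :=
    ⟨V₁.sub_starProjection_mem_orthogonal y, V.sub_mem hy (h (hp₁ y))⟩
  have e1 : ⟪V₁.starProjection y, u - V₁.starProjection u⟫ = 0 :=
    Submodule.inner_right_of_mem_orthogonal (hp₁ y) (V₁.sub_starProjection_mem_orthogonal u)
  have e2 : ⟪V₁.starProjection y, (V₁ᗮ ⊓ V).starProjection u⟫ = 0 :=
    Submodule.inner_right_of_mem_orthogonal (hp₁ y) (hp₂ u).1
  have e3 : ⟪y - V₁.starProjection y, V₁.starProjection u⟫ = 0 :=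
    Submodule.inner_left_of_mem_orthogonal (hp₁ u) hy₂.1
  have e4 : ⟪y - V₁.starProjection y, u - (V₁ᗮ ⊓ V).starProjection u⟫ = 0 :=
    Submodule.inner_right_of_mem_orthogonal hy₂ ((V₁ᗮ ⊓ V).sub_starProjection_mem_orthogonal u)
  simp only [inner_sub_left, inner_sub_right, inner_add_right] at *
  linarith

variable [MeasurableSpace E] [BorelSpace E]

/-- The Gaussian measure of the directions whose projection to `V` is close to a line in `V`. -/
lemma stdGaussian_cap {V : Submodule ℝ E} {m : ℕ} (hV : finrank ℝ V = m + 1) {w : E} (hw : w ∈ V)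
    (hw0 : w ≠ 0) (x : ℝ) :
    stdGaussian E {u | (1 - x) * ‖V.starProjection u‖ ^ 2 * ‖w‖ ^ 2 ≤ ⟪u, w⟫ ^ 2} =
      capProb m x := by
  have hle : (ℝ ∙ w) ≤ V := by simpa using hw
  have h1 : finrank ℝ (ℝ ∙ w) = 1 := finrank_span_singleton hw0
  have h2 : finrank ℝ ((ℝ ∙ w)ᗮ ⊓ V : Submodule ℝ E) = m := by
    have := Submodule.finrank_add_inf_finrank_orthogonal hle
    omega
  have hperp : (ℝ ∙ w) ⟂ ((ℝ ∙ w)ᗮ ⊓ V) :=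
    (Submodule.isOrtho_orthogonal_right _).mono_right inf_le_left
  have hS : MeasurableSet {p : ℝ × ℝ | (1 - x) * p.2 ^ 2 ≤ x * p.1 ^ 2} :=
    measurableSet_le (by fun_prop) (by fun_prop)
  have key := congrArg (fun μ => μ {p : ℝ × ℝ | (1 - x) * p.2 ^ 2 ≤ x * p.1 ^ 2})
    (stdGaussian_map_norm_pair hperp h1 h2)
  simp only at key
  rw [Measure.map_apply (by fun_prop) hS, Measure.map_apply (by fun_prop) hS] at key
  rw [capProb]
  refine Eq.trans ?_ key
  congr 1
  ext u
  simp only [Set.mem_ofPred_eq, Set.mem_preimage]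
  have hwpos : 0 < ‖w‖ ^ 2 := by have := norm_pos_iff.2 hw0; positivity
  -- With axial part `a` and transverse part `b`, the condition `(1-x)(a²+b²) ≤ a²` becomes `(1-x)b²
  -- ≤ x a²`, the event in `capProb`.
  have hsq : ‖V.starProjection u‖ ^ 2 = ‖(ℝ ∙ w).starProjection u‖ ^ 2 +
      ‖((ℝ ∙ w)ᗮ ⊓ V).starProjection u‖ ^ 2 := by
    rw [starProjection_eq_add_of_le hle, norm_add_sq_real,
      hperp.inner_eq (Submodule.starProjection_apply_mem _ _)
        (Submodule.starProjection_apply_mem _ _)]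
    ring
  rw [← norm_sq_starProjection_span_singleton_mul w u, mul_le_mul_iff_left₀ hwpos, hsq]
  constructor <;> intro h <;> linarith

/-- The Gaussian measure of a double cone around the line through `w`. -/
lemma stdGaussian_cone {m : ℕ} (hE : finrank ℝ E = m + 1) {w : E} (hw0 : w ≠ 0) (x : ℝ) :
    stdGaussian E {u | (1 - x) * ‖u‖ ^ 2 * ‖w‖ ^ 2 ≤ ⟪u, w⟫ ^ 2} = capProb m x := by
  have h := stdGaussian_cap (V := (⊤ : Submodule ℝ E)) ((finrank_top ℝ E).trans hE)
    (Submodule.mem_top (x := w)) hw0 x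
  have htop : ∀ u : E, (⊤ : Submodule ℝ E).starProjection u = u := fun u =>
    Submodule.starProjection_eq_self_iff.2 Submodule.mem_top
  simpa only [htop] using h

end CapMeasure

/-! ### Cap bounds in the form required by the error term. -/

section CapBounds

lemma capProb_le_one (m : ℕ) (x : ℝ) : capProb m x ≤ 1 := prob_le_one

/-- Taking the sine to be `2g` rather than `g` gains `2^m ≥ 4`. This pays for the cosine factor, at
least `3/4`, and for replacing `1/(m+1)` by `1/m`. -/
lemma pow_div_le_capProb {m : ℕ} (hm : 2 ≤ m) {g : ℝ} (hg0 : 0 < g) (hg1 : g ≤ 1 / 4) :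
    g ^ m / m ≤ (capProb m (4 * g ^ 2)).toReal := by
  have hx1 : 4 * g ^ 2 < 1 := by nlinarith
  have h := le_capProb (m := m) (by omega) (x := 4 * g ^ 2) (by positivity) hx1
  have hc := capConst_pos m
  have h2 := (ENNReal.ofReal_le_iff_le_toReal
    ((capProb_le_one m _).trans_lt ENNReal.one_lt_top).ne).1 h
  refine le_trans ?_ h2
  have hs : √(4 * g ^ 2) = 2 * g := by
    rw [show 4 * g ^ 2 = (2 * g) ^ 2 by ring, Real.sqrt_sq (by positivity)]
  have hs2 : 3 / 4 ≤ √(1 - 4 * g ^ 2) := by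
    apply Real.le_sqrt_of_sq_le
    nlinarith
  have hc2 := le_capConst m (by omega)
  have hm2 : (2 : ℝ) ≤ m := by exact_mod_cast hm
  have h4 : (4 : ℝ) ≤ 2 ^ m := by
    calc (4 : ℝ) = 2 ^ 2 := by norm_num
      _ ≤ 2 ^ m := pow_le_pow_right₀ (by norm_num) hm
  rw [hs, mul_pow]
  calc g ^ m / m = 1 / m * g ^ m := by ring
    _ ≤ (1 / ((m : ℝ) + 1) * 4 * (3 / 4)) * g ^ m := by
      refine mul_le_mul_of_nonneg_right ?_ (by positivity)
      rw [div_mul_eq_mul_div, div_mul_eq_mul_div, div_le_div_iff₀ (by positivity) (by positivity)]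
      linarith
    _ ≤ (capConst m * 2 ^ m * √(1 - 4 * g ^ 2)) * g ^ m := by
      gcongr
    _ = _ := by ring

/-- If the target is below 1, then `N ≥ 2 ≥ π/2` forces `√x < 2/π`, so the cosine is at least `2/π`
and the tangent at most `π/2` times the sine. The constant `2/π` saves one of the `m` factors `π/2`.
If the target is at least 1, it bounds any probability trivially. -/
lemma card_mul_capProb_le {N m : ℕ} (hN : 2 ≤ N) (hm : 1 ≤ m) {x : ℝ} (hx0 : 0 ≤ x) :
    N * (capProb m x).toReal ≤ (Real.pi / 2) ^ (m - 1) * N * √x ^ m ∨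
      1 ≤ (Real.pi / 2) ^ (m - 1) * N * √x ^ m := by
  have hpi := Real.pi_gt_three
  have hpi4 := Real.pi_lt_four
  have hN2 : (2 : ℝ) ≤ N := by exact_mod_cast hN
  refine or_iff_not_imp_right.2 fun hB => ?_
  rw [not_le] at hB
  have hpow : (Real.pi / 2) ^ m = (Real.pi / 2) ^ (m - 1) * (Real.pi / 2) := by
    rw [← pow_succ]; congr 1; omega
  have hlt : (Real.pi / 2 * √x) ^ m < 1 := by
    rw [mul_pow, hpow]
    refine lt_of_le_of_lt ?_ hB
    have : Real.pi / 2 ≤ N := by linarith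
    gcongr
  have hlt2 : Real.pi / 2 * √x < 1 := (pow_lt_one_iff_of_nonneg (by positivity) (by omega)).1 hlt
  have hx : (Real.pi / 2) ^ 2 * x < 1 := by
    rw [← Real.sq_sqrt hx0, ← mul_pow]
    exact pow_lt_one₀ (by positivity) hlt2 (by norm_num)
  have hx1 : x < 1 / 2 := by nlinarith
  have h1x : 0 < 1 - x := by linarith
  have hcos : 1 ≤ Real.pi / 2 * √(1 - x) := by
    have h : 1 ≤ (Real.pi / 2 * √(1 - x)) ^ 2 := by
      rw [mul_pow, Real.sq_sqrt h1x.le]; nlinarith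
    exact (one_le_sq_iff₀ (by positivity)).1 h
  have h := ENNReal.toReal_mono ENNReal.ofReal_ne_top (capProb_le hm hx0 (by linarith : x < 1))
  have hc := capConst_pos m
  rw [ENNReal.toReal_ofReal (by positivity)] at h
  have hfin : capConst m * √(x / (1 - x)) ^ m ≤ (Real.pi / 2) ^ (m - 1) * √x ^ m := by
    have hs : 0 < √(1 - x) := Real.sqrt_pos.2 h1x
    rw [Real.sqrt_div hx0, div_pow, ← mul_div_assoc, div_le_iff₀ (by positivity)]
    calc capConst m * √x ^ m ≤ 2 / Real.pi * √x ^ m * 1 := by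
          rw [mul_one]
          exact mul_le_mul_of_nonneg_right (capConst_le m hm) (by positivity)
      _ ≤ 2 / Real.pi * √x ^ m * (Real.pi / 2 * √(1 - x)) ^ m := by
          refine mul_le_mul_of_nonneg_left (one_le_pow₀ hcos) (by positivity)
      _ = _ := by
          rw [mul_pow, hpow]; field_simp
  calc (N : ℝ) * (capProb m x).toReal ≤ N * ((Real.pi / 2) ^ (m - 1) * √x ^ m) := by
        gcongr; exact h.trans hfin
    _ = _ := by ring

end CapBounds

/-! ### Comparison of residuals for fixed noise vectors. -/

section Deterministic

variable {E : Type*} [NormedAddCommGroup E] [InnerProductSpace ℝ E] [FiniteDimensional ℝ E]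

lemma norm_sub_starProjection_le (A : Submodule ℝ E) (y : E) {z : E} (hz : z ∈ A) :
    ‖y - A.starProjection y‖ ≤ ‖y - z‖ := by
  rw [Submodule.starProjection_minimal]
  exact ciInf_le ⟨0, by rintro _ ⟨a, rfl⟩; exact norm_nonneg _⟩ (⟨z, hz⟩ : A)

lemma norm_starProjection_le (A : Submodule ℝ E) (y : E) : ‖A.starProjection y‖ ≤ ‖y‖ := by
  simpa using A.norm_orthogonalProjectionOnto_apply_le y

omit [FiniteDimensional ℝ E] in
/-- If the angle between `a` and `w` is not small, then `w` is far from the line through `a`. -/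
lemma sqrt_mul_norm_lt_norm_add_smul {a w : E} {x : ℝ} (hx : 0 ≤ x)
    (h : ⟪a, w⟫ ^ 2 < (1 - x) * ‖a‖ ^ 2 * ‖w‖ ^ 2) (t : ℝ) :
    √x * ‖w‖ < ‖w + t • a‖ := by
  have ha : 0 < ‖a‖ := by
    by_contra hcon
    have : a = 0 := norm_eq_zero.1 (le_antisymm (not_lt.1 hcon) (norm_nonneg a))
    simp [this] at h
  have key : x * ‖w‖ ^ 2 < ‖w + t • a‖ ^ 2 := by
    rw [norm_add_sq_real, inner_smul_right, real_inner_comm, norm_smul, mul_pow,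
      Real.norm_eq_abs, sq_abs]
    have ha2 : 0 < ‖a‖ ^ 2 := by positivity
    refine lt_of_mul_lt_mul_right ?_ ha2.le
    -- Completing the square in `t`: the minimum over the line is the squared distance from `w` to
    -- it, `‖w‖²` times the squared sine.
    nlinarith [sq_nonneg (⟪a, w⟫ + t * ‖a‖ ^ 2)]
  rw [← sq_lt_sq₀ (by positivity) (norm_nonneg _), mul_pow, Real.sq_sqrt hx]
  exact key

omit [FiniteDimensional ℝ E] in
/-- Decomposition of `U` along a direction `u` that is nearly parallel to it. -/
lemma exists_norm_sub_smul_le {u U : E} {g : ℝ} (hg : 0 ≤ g) (hu : u ≠ 0)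
    (h : (1 - 4 * g ^ 2) * ‖u‖ ^ 2 * ‖U‖ ^ 2 ≤ ⟪u, U⟫ ^ 2) :
    ∃ c : ℝ, ‖U - c • u‖ ≤ 2 * g * ‖U‖ := by
  have hu2 : 0 < ‖u‖ ^ 2 := by have := norm_pos_iff.2 hu; positivity
  refine ⟨⟪u, U⟫ / ‖u‖ ^ 2, ?_⟩
  rw [← sq_le_sq₀ (norm_nonneg _) (by positivity), norm_sub_sq_real, inner_smul_right,
    real_inner_comm u U, norm_smul, mul_pow, Real.norm_eq_abs, sq_abs]
  refine le_of_mul_le_mul_right ?_ hu2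
  have e : (‖U‖ ^ 2 - 2 * (⟪u, U⟫ / ‖u‖ ^ 2 * ⟪u, U⟫) + (⟪u, U⟫ / ‖u‖ ^ 2) ^ 2 * ‖u‖ ^ 2) *
      ‖u‖ ^ 2 = ‖U‖ ^ 2 * ‖u‖ ^ 2 - ⟪u, U⟫ ^ 2 := by
    field_simp
    ring
  rw [e]
  linarith

/-- A wrong model leaves a strictly larger residual than the true one, provided that the
artificial noise `u` is nearly parallel to the noise `U` and that its projection to `V` is not
nearly parallel to the part `w` of the signal that the wrong model misses. -/
lemma residual_lt_residual {s U u w : E} {σ g x : ℝ} {V A A₀ : Submodule ℝ E} (hσ : 0 < σ)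
    (hx : 0 ≤ x)    (hg : 0 ≤ g) (hs : s ∈ A₀) (hu : u ∈ A₀)
    (hA : ∀ z ∈ A, ∃ t : ℝ, V.starProjection z = t • V.starProjection u)
    (hw : V.starProjection s = w)
    (hcap : (1 - 4 * g ^ 2) * ‖u‖ ^ 2 * ‖U‖ ^ 2 ≤ ⟪u, U⟫ ^ 2)
    (hbad : ⟪u, w⟫ ^ 2 < (1 - x) * ‖V.starProjection u‖ ^ 2 * ‖w‖ ^ 2)
    (hnorm : 4 * g * (σ * ‖U‖) ≤ √x * ‖w‖) :
    ‖(s + σ • U) - A₀.starProjection (s + σ • U)‖ <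
      ‖(s + σ • U) - A.starProjection (s + σ • U)‖ := by
  have hu0 : u ≠ 0 := by
    rintro rfl
    simp at hbad
  obtain ⟨c, hc⟩ := exists_norm_sub_smul_le hg hu0 hcap
  have hsmall : ‖σ • (U - c • u)‖ ≤ 2 * g * (σ * ‖U‖) := by
    rw [norm_smul, Real.norm_eq_abs, abs_of_pos hσ]
    calc σ * ‖U - c • u‖ ≤ σ * (2 * g * ‖U‖) := by gcongr
      _ = _ := by ring
  -- The true model contains `s + σc·u`, which already approximates the response this well.
  have h₀ : ‖(s + σ • U) - A₀.starProjection (s + σ • U)‖ ≤ 2 * g * (σ * ‖U‖) := by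
    refine (norm_sub_starProjection_le A₀ _
      (A₀.add_mem hs (A₀.smul_mem (σ * c) hu))).trans (le_trans (le_of_eq ?_) hsmall)
    congr 1
    rw [smul_sub, smul_smul]
    abel
  obtain ⟨t, ht⟩ := hA _ (A.starProjection_apply_mem (s + σ • U))
  have hinner : ⟪u, w⟫ = ⟪V.starProjection u, w⟫ := by
    rw [← hw, Submodule.inner_starProjection_left_eq_right]
    congr 1
    exact (Submodule.starProjection_eq_self_iff.2 (V.starProjection_apply_mem s)).symm
  rw [hinner] at hbad
  have h₁ := sqrt_mul_norm_lt_norm_add_smul hx hbad (σ * c - t)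
  -- Seen in `V`, the wrong fit can only add a multiple of the projected `u` to `w`. The small
  -- remainder `σ(U - c·u)` costs another `2gσ‖U‖`, whence the 4 in `hnorm`.
  have h₂ : w + (σ * c - t) • V.starProjection u =
      V.starProjection ((s + σ • U) - A.starProjection (s + σ • U)) -
        V.starProjection (σ • (U - c • u)) := by
    rw [map_sub V.starProjection, ht, map_add, hw]
    simp only [map_smul, map_sub, smul_sub, sub_smul, smul_smul]
    abel
  have h₃ := norm_sub_le (V.starProjection ((s + σ • U) - A.starProjection (s + σ • U)))
    (V.starProjection (σ • (U - c • u)))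
  have h₄ := norm_starProjection_le V ((s + σ • U) - A.starProjection (s + σ • U))
  have h₅ := norm_starProjection_le V (σ • (U - c • u))
  rw [h₂] at h₁
  linarith

end Deterministic

/-! ### Column spaces of block matrices. -/

section Matrix

variable {n : ℕ} {ι κ : Type} [Fintype ι] [DecidableEq ι] [Fintype κ] [DecidableEq κ]

lemma toEuclideanLin_mem_colSpace (A : Matrix (Fin n) ι ℝ) (v : EuclideanSpace ℝ ι) :
    Matrix.toEuclideanLin A v ∈ colSpace A := LinearMap.mem_range_self _ v

lemma colSpace_fromCols (A : Matrix (Fin n) ι ℝ) (B : Matrix (Fin n) κ ℝ) :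
    colSpace (Matrix.fromCols A B) = colSpace A ⊔ colSpace B := by
  have key : ∀ v : EuclideanSpace ℝ (ι ⊕ κ), Matrix.toEuclideanLin (Matrix.fromCols A B) v =
      Matrix.toEuclideanLin A (WithLp.toLp 2 fun i => v (Sum.inl i)) +
        Matrix.toEuclideanLin B (WithLp.toLp 2 fun i => v (Sum.inr i)) := by
    intro v
    ext i
    simp [Matrix.toLpLin_apply, Matrix.mulVec, dotProduct]
  apply le_antisymm
  · rintro _ ⟨v, rfl⟩
    rw [key]
    exact Submodule.add_mem_sup (toEuclideanLin_mem_colSpace A _) (toEuclideanLin_mem_colSpace B _)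
  · refine sup_le ?_ ?_
    · rintro _ ⟨v, rfl⟩
      refine ⟨WithLp.toLp 2 (Sum.elim v fun _ => 0), ?_⟩
      rw [key]
      ext i
      simp [Matrix.toLpLin_apply, Matrix.mulVec, dotProduct]
    · rintro _ ⟨v, rfl⟩
      refine ⟨WithLp.toLp 2 (Sum.elim (fun _ => 0) v), ?_⟩
      rw [key]
      ext i
      simp [Matrix.toLpLin_apply, Matrix.mulVec, dotProduct]

lemma colSpace_replicateCol (u : EuclideanSpace ℝ (Fin n)) :
    colSpace (Matrix.replicateCol Unit fun i => u i) = ℝ ∙ u := by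
  have key : ∀ v : EuclideanSpace ℝ Unit,
      Matrix.toEuclideanLin (Matrix.replicateCol Unit fun i => u i) v = v () • u := by
    intro v
    ext i
    simp [Matrix.toLpLin_apply, Matrix.mulVec, dotProduct, mul_comm]
  ext y
  rw [Submodule.mem_span_singleton]
  constructor
  · rintro ⟨v, rfl⟩
    exact ⟨v (), (key v).symm⟩
  · rintro ⟨c, rfl⟩
    exact ⟨WithLp.toLp 2 fun _ => c, key _⟩

lemma finrank_colSpace (A : Matrix (Fin n) ι ℝ) : finrank ℝ (colSpace A) = A.rank := by
  rw [colSpace, Matrix.toEuclideanLin_eq_toLin_orthonormal, Matrix.rank_eq_finrank_range_toLin A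
    (EuclideanSpace.basisFun (Fin n) ℝ).toBasis (EuclideanSpace.basisFun ι ℝ).toBasis]

end Matrix

lemma exists_submodule_finrank_eq {E : Type*} [AddCommGroup E] [Module ℝ E]
    [FiniteDimensional ℝ E] (H : Submodule ℝ E) {d : ℕ} (hd : d ≤ finrank ℝ H) :
    ∃ S ≤ H, finrank ℝ S = d := by
  obtain ⟨f, hf⟩ := exists_linearIndependent_of_le_finrank hd
  have hf2 : LinearIndependent ℝ fun i => (f i : E) := hf.map' H.subtype H.ker_subtype
  refine ⟨Submodule.span ℝ (Set.range fun i => (f i : E)), ?_, ?_⟩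
  · rw [Submodule.span_le]
    rintro _ ⟨i, rfl⟩
    exact (f i).2
  · rw [finrank_span_eq_card hf2, Fintype.card_fin]

/-- Add to the line through `w` an `m`-dimensional subspace of its orthogonal complement inside `H`.
-/
lemma exists_submodule_mem_finrank_eq {E : Type*} [NormedAddCommGroup E] [InnerProductSpace ℝ E]
    [FiniteDimensional ℝ E] {H : Submodule ℝ E} {w : E} (hw : w ∈ H) (hw0 : w ≠ 0) {m : ℕ}
    (hd : m + 1 ≤ finrank ℝ H) :
    ∃ V ≤ H, w ∈ V ∧ finrank ℝ V = m + 1 := by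
  have hle : (ℝ ∙ w) ≤ H := by simpa using hw
  have h1 : finrank ℝ (ℝ ∙ w) = 1 := finrank_span_singleton hw0
  have h2 := Submodule.finrank_add_inf_finrank_orthogonal hle
  obtain ⟨S, hS, hSd⟩ := exists_submodule_finrank_eq ((ℝ ∙ w)ᗮ ⊓ H) (d := m) (by omega)
  refine ⟨(ℝ ∙ w) ⊔ S, sup_le hle (hS.trans inf_le_right),
    Submodule.mem_sup_left (Submodule.mem_span_singleton_self w), ?_⟩
  have h3 := Submodule.finrank_sup_add_finrank_inf_eq (ℝ ∙ w) S
  have h4 : (ℝ ∙ w) ⊓ S = ⊥ := by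
    rw [eq_bot_iff, ← Submodule.inf_orthogonal_eq_bot (ℝ ∙ w)]
    exact inf_le_inf_left _ (hS.trans inf_le_left)
  rw [h4, finrank_bot] at h3
  omega

/-! ### Column spaces of the designs. -/

section Model

variable {n p₁ p₂ : ℕ} (X : Matrix (Fin n) (Fin p₁) ℝ) (Z : Matrix (Fin n) (Fin p₂) ℝ)

lemma signal_mem_colSpace (π : Equiv.Perm (Fin n)) (β₁ : EuclideanSpace ℝ (Fin p₁))
    (β₂ : EuclideanSpace ℝ (Fin p₂)) : signal X Z π β₁ β₂ ∈ colSpace (expDesign X Z π) := by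
  rw [expDesign, colSpace_fromCols, signal]
  exact Submodule.add_mem_sup (toEuclideanLin_mem_colSpace _ _) (toEuclideanLin_mem_colSpace _ _)

lemma colSpace_augDesign (π : Equiv.Perm (Fin n)) (u : EuclideanSpace ℝ (Fin n)) :
    colSpace (augDesign X Z π u) = colSpace (expDesign X Z π) ⊔ (ℝ ∙ u) := by
  rw [augDesign, colSpace_fromCols, colSpace_replicateCol]

lemma finrank_colSpace_expDesign_le (π : Equiv.Perm (Fin n)) :
    finrank ℝ (colSpace (expDesign X Z π)) ≤ p₁ + p₂ := by
  rw [finrank_colSpace]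
  exact (Matrix.rank_le_card_width _).trans_eq (by simp)

/-- The ranks of the two blocks must add up to at least `p₁ + p₂`, so neither can fall short of its
width. -/
lemma finrank_colSpace_right {π : Equiv.Perm (Fin n)} (h : (expDesign X Z π).rank = p₁ + p₂) :
    finrank ℝ (colSpace Z) = p₂ := by
  have h1 := Submodule.finrank_add_le_finrank_add_finrank (colSpace (permDesign X π)) (colSpace Z)
  rw [← colSpace_fromCols, ← expDesign, finrank_colSpace, h] at h1
  have h2 : finrank ℝ (colSpace (permDesign X π)) ≤ p₁ := by
    rw [finrank_colSpace]; exact (Matrix.rank_le_card_width _).trans_eq (by simp)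
  have h3 : finrank ℝ (colSpace Z) ≤ p₂ := by
    rw [finrank_colSpace]; exact (Matrix.rank_le_card_width _).trans_eq (by simp)
  omega

end Model

/-! ### Quantiles of the F distribution. -/

section FDistribution

lemma measurable_fDist_ratio (a b : ℕ) : Measurable
    fun z : EuclideanSpace ℝ (Fin a) × EuclideanSpace ℝ (Fin b) =>
      (‖z.1‖ ^ 2 / (a : ℝ)) / (‖z.2‖ ^ 2 / (b : ℝ)) := by fun_prop

instance isProbabilityMeasure_fDist (a b : ℕ) : IsProbabilityMeasure (fDist a b) :=
  Measure.isProbabilityMeasure_map (measurable_fDist_ratio a b).aemeasurable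

/-- The quantile of a probability level in `(0, 1)` is attained. -/
lemma le_cdf_fQuantile (a b : ℕ) {α : ℝ} (hα : α ∈ Set.Ioo (0 : ℝ) 1) :
    α ≤ cdf (fDist a b) (fQuantile a b α) := by
  set F := cdf (fDist a b)
  set S := {x : ℝ | α ≤ F x} with hS
  have hne : S.Nonempty :=
    ((tendsto_cdf_atTop (fDist a b)).eventually_const_le hα.2).exists
  have hbdd : BddBelow S := by
    obtain ⟨x₀, hx₀⟩ := ((tendsto_cdf_atBot (fDist a b)).eventually_lt_const hα.1).exists
    refine ⟨x₀, fun y hy => ?_⟩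
    by_contra hlt
    exact absurd ((hy.trans (F.mono (not_le.1 hlt).le)).trans_lt hx₀) (lt_irrefl _)
  have hright : ∀ y > sInf S, α ≤ F y := fun y hy => by
    obtain ⟨x, hx, hxy⟩ := exists_lt_of_csInf_lt hne hy
    exact le_trans hx (F.mono hxy.le)
  -- Right continuity carries the bound from points above the infimum to the infimum itself.
  have ht : Tendsto F (nhdsWithin (sInf S) (Set.Ioi (sInf S))) (nhds (F (sInf S))) :=
    (F.right_continuous (sInf S)).mono_left (nhdsWithin_mono _ Set.Ioi_subset_Ici_self)
  exact ge_of_tendsto ht (eventually_nhdsWithin_of_forall hright)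

end FDistribution

/-! ### Exact law of the statistic at the true parameter. -/

section Pivot

variable {n p₁ p₂ : ℕ} (X : Matrix (Fin n) (Fin p₁) ℝ) (Z : Matrix (Fin n) (Fin p₂) ℝ)

lemma inner_starProjection_self {E : Type*} [NormedAddCommGroup E] [InnerProductSpace ℝ E]
    [FiniteDimensional ℝ E] (V : Submodule ℝ E) (r : E) :
    ⟪r, V.starProjection r⟫ = ‖V.starProjection r‖ ^ 2 := by
  rw [← real_inner_self_eq_norm_sq, Submodule.inner_starProjection_left_eq_right,
    Submodule.starProjection_eq_self_iff.2 (V.starProjection_apply_mem r)]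

lemma starProjection_eq_zero_of_le {E : Type*} [NormedAddCommGroup E] [InnerProductSpace ℝ E]
    [FiniteDimensional ℝ E] {V W : Submodule ℝ E} (h : V ≤ Wᗮ) {y : E} (hy : y ∈ W) :
    V.starProjection y = 0 :=
  (Submodule.starProjection_apply_eq_zero_iff V).2
    (Submodule.orthogonal_le h (W.le_orthogonal_orthogonal hy))

/-- At the true parameter the statistic is a ratio of squared norms of orthogonal projections of
the noise. -/
lemma partialStat_response (π : Equiv.Perm (Fin n)) (β₁ : EuclideanSpace ℝ (Fin p₁))
    (β₂ : EuclideanSpace ℝ (Fin p₂)) {σ : ℝ} (hσ : 0 < σ) (hn : p₁ + p₂ ≤ n)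
    (u : EuclideanSpace ℝ (Fin n)) :
    partialStat X Z (response X Z π β₁ β₂ σ u) π β₁ =
      (‖((colSpace Z)ᗮ ⊓ colSpace (expDesign X Z π)).starProjection u‖ ^ 2 / (p₁ : ℝ)) /
        (‖(colSpace (expDesign X Z π))ᗮ.starProjection u‖ ^ 2 / ((n - (p₁ + p₂) : ℕ) : ℝ)) := by
  set W := colSpace (expDesign X Z π)
  have hZW : colSpace Z ≤ W := by
    change colSpace Z ≤ colSpace (Matrix.fromCols _ _)
    rw [colSpace_fromCols]
    exact le_sup_right
  set r := response X Z π β₁ β₂ σ u - Matrix.toEuclideanLin (permDesign X π) β₁ with hr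
  have hr2 : r = Matrix.toEuclideanLin Z β₂ + σ • u := by
    rw [hr, response, signal]; abel
  have hZ : Matrix.toEuclideanLin Z β₂ ∈ colSpace Z := toEuclideanLin_mem_colSpace Z β₂
  have e1 : proj (expDesign X Z π) r - proj Z r = ((colSpace Z)ᗮ ⊓ W).starProjection r := by
    have := starProjection_eq_add_of_le hZW r
    rw [sub_eq_iff_eq_add']
    exact this
  have e2 : r - proj (expDesign X Z π) r = Wᗮ.starProjection r := by
    rw [sub_eq_iff_eq_add']
    exact (W.starProjection_add_starProjection_orthogonal r).symm
  -- Both projections kill the nuisance term `Z β₂`; the scale `σ` later cancels in the ratio.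
  have e3 : ((colSpace Z)ᗮ ⊓ W).starProjection r = σ • ((colSpace Z)ᗮ ⊓ W).starProjection u := by
    rw [hr2, map_add, starProjection_eq_zero_of_le inf_le_left hZ, zero_add, map_smul]
  have e4 : Wᗮ.starProjection r = σ • Wᗮ.starProjection u := by
    rw [hr2, map_add, starProjection_eq_zero_of_le le_rfl (hZW hZ), zero_add, map_smul]
  have e5 : partialStat X Z (response X Z π β₁ β₂ σ u) π β₁ =
      (((n : ℝ) - ((p₁ : ℝ) + (p₂ : ℝ))) / (p₁ : ℝ)) *
        (⟪r, proj (expDesign X Z π) r - proj Z r⟫ / ⟪r, r - proj (expDesign X Z π) r⟫) := rfl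
  rw [e5, e1, e2, inner_starProjection_self, inner_starProjection_self, e3, e4, norm_smul,
    norm_smul, Nat.cast_sub hn, mul_pow, mul_pow, 
    mul_div_mul_left _ _ (pow_ne_zero 2 (norm_ne_zero_iff.2 hσ.ne'))]
  push_cast
  rw [div_div_div_eq, div_mul_div_comm]
  ring

/-- The pivotal statistic has the `F` distribution. -/
lemma stdGaussian_partialStat_le {π : Equiv.Perm (Fin n)}
    (hrank : (expDesign X Z π).rank = p₁ + p₂) (hn : p₁ + p₂ ≤ n)
    (β₁ : EuclideanSpace ℝ (Fin p₁)) (β₂ : EuclideanSpace ℝ (Fin p₂)) {σ : ℝ} (hσ : 0 < σ)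
    (x : ℝ) :
    MeasurableSet {u | partialStat X Z (response X Z π β₁ β₂ σ u) π β₁ ≤ x} ∧
    (stdGaussian (EuclideanSpace ℝ (Fin n))).real
      {u | partialStat X Z (response X Z π β₁ β₂ σ u) π β₁ ≤ x} =
        cdf (fDist p₁ (n - (p₁ + p₂))) x := by
  simp_rw [partialStat_response X Z π β₁ β₂ hσ hn]
  set W := colSpace (expDesign X Z π)
  have hW : finrank ℝ W = p₁ + p₂ := (finrank_colSpace _).trans hrank
  have hZW : colSpace Z ≤ W := by
    change colSpace Z ≤ colSpace (Matrix.fromCols _ _)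
    rw [colSpace_fromCols]
    exact le_sup_right
  have h1 : finrank ℝ ((colSpace Z)ᗮ ⊓ W : Submodule ℝ _) = p₁ := by
    have := Submodule.finrank_add_inf_finrank_orthogonal hZW
    rw [hW, finrank_colSpace_right X Z hrank] at this
    omega
  have h2 : finrank ℝ (Wᗮ : Submodule ℝ _) = n - (p₁ + p₂) := by
    have := Submodule.finrank_add_finrank_orthogonal W
    rw [hW, finrank_euclideanSpace_fin] at this
    omega
  have hperp : ((colSpace Z)ᗮ ⊓ W) ⟂ Wᗮ :=
    (Submodule.isOrtho_orthogonal_right W).mono_left inf_le_right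
  have hmS : MeasurableSet {q : ℝ × ℝ | (q.1 ^ 2 / (p₁ : ℝ)) /
      (q.2 ^ 2 / ((n - (p₁ + p₂) : ℕ) : ℝ)) ≤ x} :=
    measurableSet_le (by fun_prop) measurable_const
  refine ⟨measurableSet_le (by fun_prop) measurable_const, ?_⟩
  have key := congrArg (fun μ => μ {q : ℝ × ℝ | (q.1 ^ 2 / (p₁ : ℝ)) /
    (q.2 ^ 2 / ((n - (p₁ + p₂) : ℕ) : ℝ)) ≤ x}) (stdGaussian_map_norm_pair hperp h1 h2)
  simp only at key
  rw [Measure.map_apply (by fun_prop) hmS, Measure.map_apply (by fun_prop) hmS] at key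
  rw [cdf_eq_real, Measure.real, Measure.real, fDist,
    Measure.map_apply (measurable_fDist_ratio _ _) measurableSet_Iic]
  exact congrArg ENNReal.toReal key

end Pivot

/-! ### The probability that no artificial sample is good. -/

section Sampling

/-- Convexity of `t^L`: the base is the mixture of `1 - q` and `1` with weight `b/q` on `1`. The
correction is linear in `b` and free of `L`, so it can be integrated over the target. -/
lemma one_sub_add_pow_le {q b : ℝ} (hb : 0 ≤ b) (hbq : b ≤ q) (hq : 0 < q) (hq1 : q ≤ 1) (L : ℕ) :
    (1 - q + b) ^ L ≤ (1 - q) ^ L + b / q := by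
  have ht1 : b / q ≤ 1 := (div_le_one hq).2 hbq
  have ht0 : 0 ≤ b / q := by positivity
  have h := (convexOn_pow (𝕜 := ℝ) L).2 (show 1 - q ∈ Set.Ici (0 : ℝ) by simpa using hq1)
    (show (1 : ℝ) ∈ Set.Ici (0 : ℝ) by simp) (show 0 ≤ 1 - b / q by linarith) ht0 (by ring)
  have e : (1 - b / q) • (1 - q) + (b / q) • (1 : ℝ) = 1 - q + b := by
    simp only [smul_eq_mul]; field_simp; ring
  rw [e] at h
  refine h.trans ?_
  simp only [smul_eq_mul, one_pow, mul_one]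
  have : 0 ≤ (1 - q) ^ L := pow_nonneg (by linarith) L
  nlinarith

lemma ennreal_one_sub_add_pow_le {q b : ℝ≥0∞} (hbq : b ≤ q) (hq : q ≠ 0) (hq1 : q ≤ 1) (L : ℕ) :
    (1 - q + b) ^ L ≤ (1 - q) ^ L + b / q := by
  have hqt : q ≠ ∞ := (hq1.trans_lt ENNReal.one_lt_top).ne
  lift q to ℝ≥0 using hqt
  lift b to ℝ≥0 using (hbq.trans_lt ENNReal.coe_lt_top).ne
  have hq' : q ≠ 0 := by simpa using hq
  have hq1' : q ≤ 1 := by exact_mod_cast hq1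
  rw [← ENNReal.coe_div hq']
  norm_cast
  rw [← NNReal.coe_le_coe]
  push_cast [NNReal.coe_sub hq1']
  exact one_sub_add_pow_le b.2 (by exact_mod_cast hbq) (by positivity) (by exact_mod_cast hq1') L

/-- Let `K` be a relation such that almost every section in either direction has probability `q`.
Among `L` independent samples, the chance that none is `K`-related to the independent target and
outside the exceptional set `B` is at most `(1 - q) ^ L + μ B`. -/
lemma measure_no_good_sample_le {E : Type*} [MeasurableSpace E] (μ : Measure E)
    [IsProbabilityMeasure μ] {K : Set (E × E)} (hK : MeasurableSet K) {B : Set E}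
    (hB : MeasurableSet B) {q : ℝ≥0∞} (hq : q ≠ 0)
    (h₁ : ∀ᵐ v ∂μ, μ {u | (u, v) ∈ K} = q) (h₂ : ∀ᵐ u ∂μ, μ {v | (u, v) ∈ K} = q) (L : ℕ) :
    ((Measure.pi fun _ : Fin L => μ).prod μ) {z | ∀ l, ¬ ((z.1 l, z.2) ∈ K ∧ z.1 l ∉ B)} ≤
      (1 - q) ^ L + μ B := by
  have hq1 : q ≤ 1 := by
    obtain ⟨v, hv⟩ := h₁.exists
    rw [← hv]; exact prob_le_one
  have hqt : q ≠ ∞ := (hq1.trans_lt ENNReal.one_lt_top).ne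
  have hKB : MeasurableSet (K ∩ {z | z.1 ∈ B}) := hK.inter (measurable_fst hB)
  have hmeas : MeasurableSet
      {z : (Fin L → E) × E | ∀ l, ¬ ((z.1 l, z.2) ∈ K ∧ z.1 l ∉ B)} := by
    simp only [Set.ofPred_forall]
    refine MeasurableSet.iInter fun l => MeasurableSet.compl ?_
    have hm : Measurable fun z : (Fin L → E) × E => (z.1 l, z.2) := by fun_prop
    exact hm (hK.inter (measurable_fst hB).compl)
  rw [Measure.prod_apply_symm hmeas]
  have hb : ∀ v, μ {u | (u, v) ∈ K ∩ {z | z.1 ∈ B}} ≤ μ {u | (u, v) ∈ K} := fun v =>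
    measure_mono fun u hu => hu.1
  calc _ ≤ ∫⁻ v, ((1 - q) ^ L + μ {u | (u, v) ∈ K ∩ {z | z.1 ∈ B}} / q) ∂μ := by
        refine lintegral_mono_ae ?_
        filter_upwards [h₁] with v hv
        have hKv : MeasurableSet {u | (u, v) ∈ K} := measurable_prodMk_right hK
        have e : (fun us : Fin L → E => (us, v)) ⁻¹'
            {z | ∀ l, ¬ ((z.1 l, z.2) ∈ K ∧ z.1 l ∉ B)} =
            Set.univ.pi fun _ => {u | ¬ ((u, v) ∈ K ∧ u ∉ B)} := by
          ext us; simp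
        rw [e, Measure.pi_pi, Finset.prod_const, Finset.card_univ, Fintype.card_fin]
        refine (pow_le_pow_left' ?_ L).trans
          (ennreal_one_sub_add_pow_le ((hb v).trans_eq hv) hq hq1 L)
        refine (measure_mono (t := {u | (u, v) ∈ K}ᶜ ∪ {u | (u, v) ∈ K ∩ {z | z.1 ∈ B}})
          fun u hu => ?_).trans ((measure_union_le _ _).trans_eq ?_)
        · by_cases huK : (u, v) ∈ K
          · exact Or.inr ⟨huK, by_contra fun hnB => hu ⟨huK, hnB⟩⟩
          · exact Or.inl huK
        · rw [prob_compl_eq_one_sub hKv, hv]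
    _ = (1 - q) ^ L + (∫⁻ v, μ {u | (u, v) ∈ K ∩ {z | z.1 ∈ B}} ∂μ) / q := by
        rw [lintegral_add_left measurable_const, lintegral_const, measure_univ, mul_one]
        simp_rw [div_eq_mul_inv]
        congr 1
        exact lintegral_mul_const _ (measurable_measure_prodMk_right hKB)
    _ = (1 - q) ^ L + μ B := by
        -- Exchange the order of integration: for each `u ∈ B` the section of `K` in the other
        -- variable again has measure `q`, which cancels the division by `q`.
        have e1 : ∫⁻ v, μ {u | (u, v) ∈ K ∩ {z | z.1 ∈ B}} ∂μ = q * μ B := by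
          have e2 : ∫⁻ v, μ {u | (u, v) ∈ K ∩ {z | z.1 ∈ B}} ∂μ =
              (μ.prod μ) (K ∩ {z | z.1 ∈ B}) := (Measure.prod_apply_symm hKB).symm
          rw [e2, Measure.prod_apply hKB, ← setLIntegral_const, ← lintegral_indicator hB]
          refine lintegral_congr_ae ?_
          filter_upwards [h₂] with u hu
          by_cases huB : u ∈ B
          · rw [Set.indicator_of_mem huB, ← hu]
            congr 1
            ext v
            simp [huB]
          · rw [Set.indicator_of_notMem huB]
            convert measure_empty (μ := μ)
            ext v
            simp [huB]
        rw [e1, mul_comm, ENNReal.mul_div_cancel_right hq hqt]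

end Sampling

/-! ### Separation of wrong permutations from the true one. -/

section Model

variable {n p₁ p₂ k : ℕ} {X : Matrix (Fin n) (Fin p₁) ℝ} {Z : Matrix (Fin n) (Fin p₂) ℝ}
  {π₀ : Equiv.Perm (Fin n)} {β₁ : EuclideanSpace ℝ (Fin p₁)} {β₂ : EuclideanSpace ℝ (Fin p₂)}

/-- The part of the signal that the model with permutation `π` misses. -/
noncomputable def missedSignal (X : Matrix (Fin n) (Fin p₁) ℝ) (Z : Matrix (Fin n) (Fin p₂) ℝ)
    (π₀ : Equiv.Perm (Fin n)) (β₁ : EuclideanSpace ℝ (Fin p₁)) (β₂ : EuclideanSpace ℝ (Fin p₂))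
    (π : Equiv.Perm (Fin n)) : EuclideanSpace ℝ (Fin n) :=
  signal X Z π₀ β₁ β₂ - proj (expDesign X Z π) (signal X Z π₀ β₁ β₂)

lemma exists_ne_of_sepConst_pos (h : 0 < sepConst k X Z π₀ β₁ β₂) :
    ∃ π ∈ sparsePerms n k, π ≠ π₀ := by
  by_contra! hcon
  have : IsEmpty {π : Equiv.Perm (Fin n) // π ∈ sparsePerms n k ∧ π ≠ π₀} :=
    ⟨fun π => π.2.2 (hcon π.1 π.2.1)⟩
  rw [sepConst, Real.iInf_of_isEmpty] at h
  exact lt_irrefl _ h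

/-- The maximum in the denominator is at least 1; only this weaker, uniform separation is needed. -/
lemma mul_sepConst_le (hn : 0 < n) {π : Equiv.Perm (Fin n)} (hπ : π ∈ sparsePerms n k)
    (hne : π ≠ π₀) :
    n * sepConst k X Z π₀ β₁ β₂ ≤ ‖missedSignal X Z π₀ β₁ β₂ π‖ ^ 2 := by
  have hn' : (0 : ℝ) < n := by exact_mod_cast hn
  have h : sepConst k X Z π₀ β₁ β₂ ≤ ‖missedSignal X Z π₀ β₁ β₂ π‖ ^ 2 /
      ((n : ℝ) * max ((hammingId π₀ : ℝ) - (hammingId π : ℝ)) 1) :=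
    ciInf_le (Set.finite_range _).bddBelow
      (⟨π, hπ, hne⟩ : {π : Equiv.Perm (Fin n) // π ∈ sparsePerms n k ∧ π ≠ π₀})
  have h1 : (1 : ℝ) ≤ max ((hammingId π₀ : ℝ) - (hammingId π : ℝ)) 1 := le_max_right _ _
  rw [← le_div_iff₀' hn']
  refine h.trans (div_le_div_of_nonneg_left (by positivity) hn' ?_)
  nlinarith

lemma missedSignal_ne_zero (hn : 0 < n) (hsep : 0 < sepConst k X Z π₀ β₁ β₂)
    {π : Equiv.Perm (Fin n)} (hπ : π ∈ sparsePerms n k) (hne : π ≠ π₀) :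
    missedSignal X Z π₀ β₁ β₂ π ≠ 0 := by
  intro h0
  have h := mul_sepConst_le (X := X) (Z := Z) (β₁ := β₁) (β₂ := β₂) hn hπ hne
  have : (0 : ℝ) < n * sepConst k X Z π₀ β₁ β₂ := mul_pos (by exact_mod_cast hn) hsep
  rw [h0] at h
  simp at h
  linarith

/-- Otherwise there are no regressors and the signal vanishes. The bound supplies the dimension `n -
1 ≥ 2` required by `pow_div_le_capProb`. -/
lemma three_le_of_sepConst_pos (hn : p₁ + p₂ + 1 < n) (hsep : 0 < sepConst k X Z π₀ β₁ β₂) :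
    3 ≤ n := by
  by_contra hlt
  have hp : p₁ + p₂ = 0 := by omega
  obtain ⟨π, hπ, hne⟩ := exists_ne_of_sepConst_pos hsep
  refine missedSignal_ne_zero (by omega) hsep hπ hne ?_
  have h1 := finrank_colSpace_expDesign_le X Z π₀
  rw [hp, Nat.le_zero, Submodule.finrank_eq_zero] at h1
  have h2 := signal_mem_colSpace X Z π₀ β₁ β₂
  rw [h1, Submodule.mem_bot] at h2
  rw [missedSignal, h2, map_zero, sub_zero]

/-- A subspace of dimension `n - p` orthogonal to the wrong model that detects the missed part of
the signal. -/
lemma exists_detecting_submodule (hn : p₁ + p₂ + 1 < n) {π : Equiv.Perm (Fin n)}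
    (hw : missedSignal X Z π₀ β₁ β₂ π ≠ 0) :
    ∃ V : Submodule ℝ (EuclideanSpace ℝ (Fin n)), V ≤ (colSpace (expDesign X Z π))ᗮ ∧
      missedSignal X Z π₀ β₁ β₂ π ∈ V ∧ finrank ℝ V = n - (p₁ + p₂) - 1 + 1 := by
  refine exists_submodule_mem_finrank_eq
    ((colSpace (expDesign X Z π)).sub_starProjection_mem_orthogonal _) hw ?_
  -- A wrong design may be rank deficient; its orthogonal complement is then only larger, so a
  -- subspace of dimension exactly `n - p` still fits and one cap probability serves every `π`.
  have h1 := finrank_colSpace_expDesign_le X Z π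
  have h2 := Submodule.finrank_add_finrank_orthogonal (colSpace (expDesign X Z π))
  rw [finrank_euclideanSpace_fin] at h2
  omega

/-- If `u` is nearly parallel to the noise `U` but its projection to `V` is not nearly parallel to
the missed signal, then the wrong permutation has a strictly larger objective. -/
lemma reproObjective_lt {σ g x : ℝ} (hσ : 0 < σ) (hg : 0 ≤ g) (hx : 0 ≤ x)
    {π : Equiv.Perm (Fin n)} {V : Submodule ℝ (EuclideanSpace ℝ (Fin n))}
    (hV : V ≤ (colSpace (expDesign X Z π))ᗮ) (hwV : missedSignal X Z π₀ β₁ β₂ π ∈ V)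
    {u U : EuclideanSpace ℝ (Fin n)}
    (hcap : (1 - 4 * g ^ 2) * ‖u‖ ^ 2 * ‖U‖ ^ 2 ≤ ⟪u, U⟫ ^ 2)
    (hbad : ⟪u, missedSignal X Z π₀ β₁ β₂ π⟫ ^ 2 <
      (1 - x) * ‖V.starProjection u‖ ^ 2 * ‖missedSignal X Z π₀ β₁ β₂ π‖ ^ 2)
    (hnorm : 4 * g * (σ * ‖U‖) ≤ √x * ‖missedSignal X Z π₀ β₁ β₂ π‖) :
    reproObjective X Z (response X Z π₀ β₁ β₂ σ U) u π₀ <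
      reproObjective X Z (response X Z π₀ β₁ β₂ σ U) u π := by
  have hzero : ∀ y ∈ colSpace (expDesign X Z π), V.starProjection y = 0 := fun y hy =>
    starProjection_eq_zero_of_le hV hy
  refine pow_lt_pow_left₀ (residual_lt_residual (V := V) hσ hx hg ?_ ?_ ?_ ?_ hcap hbad hnorm)
    (norm_nonneg _) two_ne_zero
  · rw [colSpace_augDesign]
    exact Submodule.mem_sup_left (signal_mem_colSpace X Z π₀ β₁ β₂)
  · rw [colSpace_augDesign]
    exact Submodule.mem_sup_right (Submodule.mem_span_singleton_self u)
  · intro z hz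
    rw [colSpace_augDesign] at hz
    obtain ⟨y, hy, v, hv, rfl⟩ := Submodule.mem_sup.1 hz
    obtain ⟨t, rfl⟩ := Submodule.mem_span_singleton.1 hv
    exact ⟨t, by rw [map_add, hzero y hy, zero_add, map_smul]⟩
  · have h1 : signal X Z π₀ β₁ β₂ = missedSignal X Z π₀ β₁ β₂ π +
        proj (expDesign X Z π) (signal X Z π₀ β₁ β₂) := by rw [missedSignal]; abel
    have h2 : V.starProjection (proj (expDesign X Z π) (signal X Z π₀ β₁ β₂)) = 0 :=
      hzero _ (Submodule.starProjection_apply_mem _ _)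
    rw [h1, map_add, h2, add_zero]
    exact Submodule.starProjection_eq_self_iff.2 hwV

end Model

/-! ### Elementary bounds and the part of `Delta` that is used. -/

section RealBounds

lemma one_le_log_exp_one_div {g : ℝ} (hg0 : 0 < g) (hg1 : g ≤ 1) :
    1 ≤ Real.log (Real.exp 1 / g) := by
  rw [Real.le_log_iff_exp_le (by positivity), le_div_iff₀ hg0]
  exact mul_le_of_le_one_right (Real.exp_nonneg 1) hg1

lemma mul_log_exp_one_div_le_one {g : ℝ} (hg0 : 0 < g) :
    g * Real.log (Real.exp 1 / g) ≤ 1 := by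
  have h := Real.log_le_sub_one_of_pos (inv_pos.2 hg0)
  rw [div_eq_mul_inv, Real.log_mul (Real.exp_ne_zero 1) (inv_ne_zero hg0.ne'), Real.log_exp]
  calc g * (1 + Real.log g⁻¹) ≤ g * (1 + (g⁻¹ - 1)) := by gcongr
    _ = 1 := by field_simp; ring

lemma Psi_one : Psi 1 = 0 := by simp [Psi]

/-- `Delta` dominates one exponential tail plus the union bound over spherical caps. -/
lemma tail_add_cap_le_Delta {n p k : ℕ} (hn : p + 1 < n) (C σ g : ℝ)
    (hx : 0 ≤ g * Real.log (Real.exp 1 / g)) :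
    Real.exp (-((n : ℝ) / 2) *
        Psi (max 1 (C * Real.log (Real.exp 1 / g) ^ 2 / (16 * σ ^ 2)))) +
      (Real.pi / 2) ^ (n - p - 1 - 1) * (sparsePerms n k).card *
        √(g * Real.log (Real.exp 1 / g)) ^ (n - p - 1) ≤ Delta n p k C σ g := by
  rw [Delta]
  set ℓ := Real.log (Real.exp 1 / g)
  refine add_le_add ?_ (le_of_eq ?_)
  -- The term `m = n` has coefficient 1, since the empty set has one derangement; all other terms
  -- are nonnegative and are dropped.
  · have h := Finset.single_le_sum (f := fun m : ℕ => (n.choose m : ℝ) *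
      (numDerangements (n - m) : ℝ) * (Real.exp (-((n : ℝ) / 2) *
          Psi (max 1 (C * ℓ / (2 * σ ^ 2 * g)))) +
        Real.exp (-((n : ℝ) / 2) * Psi (max 1 (C * ℓ ^ 2 / (16 * σ ^ 2))))))
      (fun m _ => by positivity) 
      (Finset.mem_Icc.2 ⟨Nat.sub_le n k, le_rfl⟩ : n ∈ Finset.Icc (n - k) n)
    refine le_trans ?_ h
    simp only [Nat.choose_self, Nat.sub_self, numDerangements_zero, Nat.cast_one, mul_one, one_mul]
    exact le_add_of_nonneg_left (Real.exp_nonneg _)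
  · have e1 : (n : ℝ) - (p : ℝ) - 2 = ((n - p - 1 - 1 : ℕ) : ℝ) := by
      rw [show n - p - 1 - 1 = n - (p + 2) by omega, Nat.cast_sub (by omega)]
      push_cast; ring
    have e2 : ((n : ℝ) - (p : ℝ) - 1) / 2 = (1 / 2) * ((n - p - 1 : ℕ) : ℝ) := by
      rw [show n - p - 1 = n - (p + 1) by omega, Nat.cast_sub (by omega)]
      push_cast; ring
    rw [e1, e2, Real.rpow_natCast, Real.rpow_mul hx, Real.rpow_natCast, ← Real.sqrt_eq_rpow]

end RealBounds

lemma stdGaussian_mul_le_norm_sq_le {n : ℕ} (x : ℝ) :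
    (stdGaussian (EuclideanSpace ℝ (Fin n))).real {u | (n : ℝ) * x ≤ ‖u‖ ^ 2} ≤
      Real.exp (-((n : ℝ) / 2) * Psi (max 1 x)) := by
  rcases le_total 1 x with h | h
  · rw [max_eq_right h]
    simpa using stdGaussian_norm_sq_ge_le (E := EuclideanSpace ℝ (Fin n)) h
  · rw [max_eq_left h, Psi_one, mul_zero, Real.exp_zero]
    exact measureReal_le_one

/-! ### Recovery of the true permutation with high probability. -/

section Model

variable {n p₁ p₂ k : ℕ} {X : Matrix (Fin n) (Fin p₁) ℝ} {Z : Matrix (Fin n) (Fin p₂) ℝ}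
  {π₀ : Equiv.Perm (Fin n)} {β₁ : EuclideanSpace ℝ (Fin p₁)} {β₂ : EuclideanSpace ℝ (Fin p₂)}

lemma two_le_card_sparsePerms (hπ₀ : π₀ ∈ sparsePerms n k)
    (hsep : 0 < sepConst k X Z π₀ β₁ β₂) : 2 ≤ (sparsePerms n k).card := by
  obtain ⟨π, hπ, hne⟩ := exists_ne_of_sepConst_pos hsep
  exact Finset.one_lt_card.2 ⟨π, hπ, π₀, hπ₀, hne⟩

/-- The artificial noise vectors whose projection is nearly parallel to a missed signal. -/
lemma exists_exceptional_set (hπ₀ : π₀ ∈ sparsePerms n k) (hn : p₁ + p₂ + 1 < n)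
    (hsep : 0 < sepConst k X Z π₀ β₁ β₂) {x : ℝ} (hx : 0 ≤ x) :
    ∃ B : Set (EuclideanSpace ℝ (Fin n)), MeasurableSet B ∧
      (stdGaussian (EuclideanSpace ℝ (Fin n))).real B ≤
        (Real.pi / 2) ^ (n - (p₁ + p₂) - 1 - 1) * (sparsePerms n k).card *
          √x ^ (n - (p₁ + p₂) - 1) ∧
      ∀ u ∉ B, ∀ π ∈ sparsePerms n k, π ≠ π₀ → ∃ V : Submodule ℝ (EuclideanSpace ℝ (Fin n)),
        V ≤ (colSpace (expDesign X Z π))ᗮ ∧ missedSignal X Z π₀ β₁ β₂ π ∈ V ∧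
        ⟪u, missedSignal X Z π₀ β₁ β₂ π⟫ ^ 2 <
          (1 - x) * ‖V.starProjection u‖ ^ 2 * ‖missedSignal X Z π₀ β₁ β₂ π‖ ^ 2 := by
  have hne0 : ∀ π ∈ (sparsePerms n k).erase π₀, missedSignal X Z π₀ β₁ β₂ π ≠ 0 := fun π hπ =>
    missedSignal_ne_zero (by omega) hsep (Finset.mem_of_mem_erase hπ) (Finset.ne_of_mem_erase hπ)
  have hex : ∀ π : Equiv.Perm (Fin n), ∃ V : Submodule ℝ (EuclideanSpace ℝ (Fin n)),
      π ∈ (sparsePerms n k).erase π₀ → V ≤ (colSpace (expDesign X Z π))ᗮ ∧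
        missedSignal X Z π₀ β₁ β₂ π ∈ V ∧ finrank ℝ V = n - (p₁ + p₂) - 1 + 1 := by
    intro π
    by_cases hπ : π ∈ (sparsePerms n k).erase π₀
    · obtain ⟨V, hV⟩ := exists_detecting_submodule hn (hne0 π hπ)
      exact ⟨V, fun _ => hV⟩
    · exact ⟨⊥, fun h => absurd h hπ⟩
  choose V hV using hex
  set w := missedSignal X Z π₀ β₁ β₂
  set D : Equiv.Perm (Fin n) → Set (EuclideanSpace ℝ (Fin n)) := fun π =>
    {u | (1 - x) * ‖(V π).starProjection u‖ ^ 2 * ‖w π‖ ^ 2 ≤ ⟪u, w π⟫ ^ 2} with hD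
  set μ := stdGaussian (EuclideanSpace ℝ (Fin n))
  refine ⟨⋃ π ∈ (sparsePerms n k).erase π₀, D π, ?_, ?_, ?_⟩
  · exact Finset.measurableSet_biUnion _ fun π _ => measurableSet_le (by fun_prop) (by fun_prop)
  · have h1 : μ.real (⋃ π ∈ (sparsePerms n k).erase π₀, D π) ≤
        (sparsePerms n k).card * (capProb (n - (p₁ + p₂) - 1) x).toReal := by
      refine (measureReal_biUnion_finset_le _ _).trans ?_
      calc ∑ π ∈ (sparsePerms n k).erase π₀, μ.real (D π)
          = ∑ π ∈ (sparsePerms n k).erase π₀, (capProb (n - (p₁ + p₂) - 1) x).toReal :=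
            Finset.sum_congr rfl fun π hπ => by
              rw [Measure.real, hD, stdGaussian_cap (hV π hπ).2.2 (hV π hπ).2.1 (hne0 π hπ)]
        _ = ((sparsePerms n k).erase π₀).card * (capProb (n - (p₁ + p₂) - 1) x).toReal := by
            rw [Finset.sum_const, nsmul_eq_mul]
        _ ≤ _ := by
            gcongr
            exact Finset.erase_subset _ _
    rcases card_mul_capProb_le (two_le_card_sparsePerms hπ₀ hsep)
      (show 1 ≤ n - (p₁ + p₂) - 1 by omega) hx with h2 | h2
    · exact h1.trans h2
    · exact measureReal_le_one.trans h2
  · intro u hu π hπ hne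
    have hmem : π ∈ (sparsePerms n k).erase π₀ := Finset.mem_erase.2 ⟨hne, hπ⟩
    refine ⟨V π, (hV π hmem).1, (hV π hmem).2.1, ?_⟩
    by_contra hcon
    exact hu (Set.mem_biUnion (Finset.mem_coe.2 hmem) (not_lt.1 hcon))

/-- With probability at least `1 - Δ(g) - (1 - g ^ (n - 1) / (n - 1)) ^ L`, for one of the artificial
noise vectors the true permutation is the unique minimizer. -/
lemma exists_failure_set (hπ₀ : π₀ ∈ sparsePerms n k) (hn : p₁ + p₂ + 1 < n)
    (hsep : 0 < sepConst k X Z π₀ β₁ β₂) {σ : ℝ} (hσ : 0 < σ) {g : ℝ} (hg0 : 0 < g)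
    (hg1 : g ≤ 1 / 4) (L : ℕ) :
    ∃ F : Set ((Fin L → EuclideanSpace ℝ (Fin n)) × EuclideanSpace ℝ (Fin n)),
      ((Measure.pi fun _ : Fin L => stdGaussian (EuclideanSpace ℝ (Fin n))).prod
        (stdGaussian (EuclideanSpace ℝ (Fin n)))).real F ≤
          Delta n (p₁ + p₂) k (sepConst k X Z π₀ β₁ β₂) σ g +
            (1 - g ^ (n - 1) / ((n : ℝ) - 1)) ^ L ∧
      ∀ z ∉ F, ∃ l, ∀ π ∈ sparsePerms n k, π ≠ π₀ →
        reproObjective X Z (response X Z π₀ β₁ β₂ σ z.2) (z.1 l) π₀ <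
          reproObjective X Z (response X Z π₀ β₁ β₂ σ z.2) (z.1 l) π := by
  set C := sepConst k X Z π₀ β₁ β₂
  set ℓ := Real.log (Real.exp 1 / g) with hℓ
  set μ := stdGaussian (EuclideanSpace ℝ (Fin n))
  have hn3 := three_le_of_sepConst_pos hn hsep
  have hℓ1 : 1 ≤ ℓ := one_le_log_exp_one_div hg0 (by linarith)
  have hx0 : 0 ≤ g * ℓ := by positivity
  have hx1 : g * ℓ ≤ 1 := mul_log_exp_one_div_le_one hg0
  obtain ⟨B, hBm, hBμ, hB⟩ := exists_exceptional_set (X := X) (Z := Z) (β₁ := β₁) (β₂ := β₂)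
    hπ₀ hn hsep hx0
  set K : Set (EuclideanSpace ℝ (Fin n) × EuclideanSpace ℝ (Fin n)) :=
    {z | (1 - 4 * g ^ 2) * ‖z.1‖ ^ 2 * ‖z.2‖ ^ 2 ≤ ⟪z.1, z.2⟫ ^ 2} with hK
  have hKm : MeasurableSet K := measurableSet_le (by fun_prop) (by fun_prop)
  set q := capProb (n - 1) (4 * g ^ 2)
  have hrank : finrank ℝ (EuclideanSpace ℝ (Fin n)) = n - 1 + 1 := by
    rw [finrank_euclideanSpace_fin]; omega
  have hnontriv : Nontrivial (EuclideanSpace ℝ (Fin n)) :=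
    nontrivial_of_finrank_pos (R := ℝ) (by rw [hrank]; omega)
  have hae : ∀ᵐ v ∂μ, v ≠ 0 := by
    rw [ae_iff]; simpa using stdGaussian_singleton (0 : EuclideanSpace ℝ (Fin n))
  have h₁ : ∀ᵐ v ∂μ, μ {u | (u, v) ∈ K} = q := by
    filter_upwards [hae] with v hv using stdGaussian_cone hrank hv _
  have h₂ : ∀ᵐ u ∂μ, μ {v | (u, v) ∈ K} = q := by
    filter_upwards [hae] with u hu
    refine Eq.trans ?_ (stdGaussian_cone hrank hu (4 * g ^ 2))
    congr 1
    ext v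
    simp only [hK, Set.mem_ofPred_eq, real_inner_comm u v]
    rw [mul_right_comm]
  have hqlow : g ^ (n - 1) / ((n - 1 : ℕ) : ℝ) ≤ q.toReal :=
    pow_div_le_capProb (by omega) hg0 hg1
  have hn1 : (0 : ℝ) < ((n - 1 : ℕ) : ℝ) := by exact_mod_cast (by omega : 0 < n - 1)
  have hq0 : q ≠ 0 := by
    intro h0
    rw [h0] at hqlow
    have : 0 < g ^ (n - 1) / ((n - 1 : ℕ) : ℝ) := by positivity
    simp at hqlow
    linarith
  have hq1 : q ≤ 1 := capProb_le_one _ _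
  have hsample := measure_no_good_sample_le μ hKm hBm hq0 h₁ h₂ L
  set Q := (Measure.pi fun _ : Fin L => μ).prod μ
  set F₁ : Set ((Fin L → EuclideanSpace ℝ (Fin n)) × EuclideanSpace ℝ (Fin n)) :=
    {z | ∀ l, ¬ ((z.1 l, z.2) ∈ K ∧ z.1 l ∉ B)}
  set F₂ : Set ((Fin L → EuclideanSpace ℝ (Fin n)) × EuclideanSpace ℝ (Fin n)) :=
    Prod.snd ⁻¹' {u | (n : ℝ) * (C * ℓ ^ 2 / (16 * σ ^ 2)) ≤ ‖u‖ ^ 2}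
  refine ⟨F₁ ∪ F₂, ?_, ?_⟩
  · have hF₁ : Q.real F₁ ≤ (1 - g ^ (n - 1) / ((n : ℝ) - 1)) ^ L + μ.real B := by
      have h := ENNReal.toReal_mono (by finiteness) hsample
      rw [ENNReal.toReal_add (by finiteness) (by finiteness), ENNReal.toReal_pow,
        ENNReal.toReal_sub_of_le hq1 ENNReal.one_ne_top, ENNReal.toReal_one] at h
      refine h.trans (add_le_add_left (pow_le_pow_left₀ ?_ ?_ L) _)
      · have := ENNReal.toReal_mono ENNReal.one_ne_top hq1
        rw [ENNReal.toReal_one] at this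
        linarith
      · rw [Nat.cast_sub (by omega), Nat.cast_one] at hqlow
        linarith
    have hF₂ : Q.real F₂ ≤ Real.exp (-((n : ℝ) / 2) * Psi (max 1 (C * ℓ ^ 2 / (16 * σ ^ 2)))) := by
      have h : Q.real F₂ = μ.real {u | (n : ℝ) * (C * ℓ ^ 2 / (16 * σ ^ 2)) ≤ ‖u‖ ^ 2} :=
        congrArg ENNReal.toReal (measurePreserving_snd.measure_preimage
          (measurableSet_le measurable_const (by fun_prop)).nullMeasurableSet)
      rw [h]
      exact stdGaussian_mul_le_norm_sq_le _
    have hΔ := tail_add_cap_le_Delta (k := k) hn C σ g hx0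
    have := measureReal_union_le (μ := Q) F₁ F₂
    linarith
  · intro z hz
    have hz₁ : z ∉ F₁ := fun h => hz (Or.inl h)
    have hz₂ : z ∉ F₂ := fun h => hz (Or.inr h)
    simp only [F₁, Set.mem_ofPred_eq, not_forall, not_not] at hz₁
    obtain ⟨l, hlK, hlB⟩ := hz₁
    refine ⟨l, fun π hπ hne => ?_⟩
    obtain ⟨V, hV, hwV, hbad⟩ := hB _ hlB π hπ hne
    refine reproObjective_lt hσ hg0.le hx0 hV hwV hlK hbad ?_
    have hsepπ := mul_sepConst_le (X := X) (Z := Z) (β₁ := β₁) (β₂ := β₂) (by omega) hπ hne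
    have hz₃ : ‖z.2‖ ^ 2 < n * (C * ℓ ^ 2 / (16 * σ ^ 2)) := not_le.1 hz₂
    set W := ‖missedSignal X Z π₀ β₁ β₂ π‖
    have hW : 0 ≤ W := norm_nonneg _
    have h4 : σ * ‖z.2‖ ≤ W * ℓ / 4 := by
      rw [← sq_le_sq₀ (by positivity) (by positivity)]
      rw [← mul_div_assoc, lt_div_iff₀ (by positivity)] at hz₃
      nlinarith [mul_le_mul_of_nonneg_right hsepπ (sq_nonneg ℓ)]
    -- As `gℓ ≤ 1`, the norm bound `h4` meets the requirement `4gσ‖U‖ ≤ √(gℓ)·‖w‖`.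
    have h5 : g * ℓ ≤ √(g * ℓ) := Real.le_sqrt_of_sq_le (by nlinarith)
    calc 4 * g * (σ * ‖z.2‖) ≤ 4 * g * (W * ℓ / 4) := by gcongr
      _ = g * ℓ * W := by ring
      _ ≤ _ := by gcongr

end Model

/-! ### Asymptotics of the error term. -/

section Rates

lemma half_sub_one_le_Psi {x : ℝ} (hx : 0 < x) : x / 2 - 1 ≤ Psi x := by
  have h1 := Real.log_le_sub_one_of_pos (show 0 < x / 2 by positivity)
  have h2 := Real.log_two_lt_d9
  rw [Real.log_div hx.ne' two_ne_zero] at h1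
  rw [Psi]
  linarith

lemma exp_neg_mul_Psi_max_le {c x : ℝ} (hc : 0 ≤ c) :
    Real.exp (-c * Psi (max 1 x)) ≤ Real.exp c * Real.exp (-(c / 2) * x) := by
  rw [← Real.exp_add]
  refine Real.exp_le_exp.2 ?_
  have h1 := half_sub_one_le_Psi (show 0 < max 1 x by positivity)
  have h2 : x ≤ max 1 x := le_max_right _ _
  nlinarith [mul_le_mul_of_nonneg_left h1 hc, mul_le_mul_of_nonneg_left h2 hc]

variable {n p : ℕ}

lemma gammaL_pos (hn : 2 ≤ n) {L : ℕ} (hL : 1 ≤ L) : 0 < gammaL n L := by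
  have h1 : (1 : ℝ) < n := by exact_mod_cast hn
  have h2 : (1 : ℝ) ≤ L := by exact_mod_cast hL
  have h3 : 0 < Real.log (Real.exp 1 * L) := by
    rw [Real.log_mul (Real.exp_ne_zero 1) (by positivity), Real.log_exp]
    have := Real.log_nonneg h2
    linarith
  have h4 : 0 < (n : ℝ) - 1 := by linarith
  exact lt_min (by norm_num) (by positivity)

lemma gammaL_le (n L : ℕ) : gammaL n L ≤ 1 / 4 := min_le_left _ _

lemma log_exp_one_div {g : ℝ} (hg : 0 < g) :
    Real.log (Real.exp 1 / g) = 1 - Real.log g := by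
  rw [Real.log_div (Real.exp_ne_zero 1) hg.ne', Real.log_exp]

lemma tendsto_natCast_log : Tendsto (fun L : ℕ => Real.log (L : ℝ)) atTop atTop :=
  Real.tendsto_log_atTop.comp tendsto_natCast_atTop_atTop

lemma eventually_mul_one_add_log_le (a r : ℝ) (hr : 0 < r) :
    ∀ᶠ L : ℕ in atTop, a * (1 + Real.log (L : ℝ)) ≤ (L : ℝ) ^ r := by
  have h1 : (fun L : ℕ => a * (1 + Real.log (L : ℝ))) =o[atTop] fun L : ℕ => (L : ℝ) ^ r := by
    refine IsLittleO.const_mul_left (IsLittleO.add ?_ ?_) a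
    · refine (isLittleO_const_left.2 (Or.inr ?_))
      exact tendsto_norm_atTop_atTop.comp
        ((tendsto_rpow_atTop hr).comp tendsto_natCast_atTop_atTop)
    · exact (isLittleO_log_rpow_atTop hr).comp_tendsto tendsto_natCast_atTop_atTop
  filter_upwards [h1.bound one_pos] with L hL
  rw [one_mul, Real.norm_of_nonneg (Real.rpow_nonneg (Nat.cast_nonneg L) r)] at hL
  exact (le_abs_self _).trans hL

/-- The size of `gammaL n L` and of its logarithm for large `L`. -/
lemma eventually_gammaL (hn : 2 ≤ n) : ∀ᶠ L : ℕ in atTop,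
    1 ≤ Real.log (L : ℝ) ∧ 1 ≤ L ∧
    gammaL n L = (((n : ℝ) - 1) * (1 + Real.log (L : ℝ)) / (L : ℝ)) ^ (1 / ((n : ℝ) - 1)) ∧
    Real.log (L : ℝ) / (2 * ((n : ℝ) - 1)) ≤ Real.log (Real.exp 1 / gammaL n L) ∧
    Real.log (Real.exp 1 / gammaL n L) ≤ 2 * Real.log (L : ℝ) := by
  have h1 : (2 : ℝ) ≤ n := by exact_mod_cast hn
  set a : ℝ := (n : ℝ) - 1 with ha
  have ha1 : 1 ≤ a := by linarith
  filter_upwards [tendsto_natCast_log.eventually_ge_atTop 1, eventually_ge_atTop 1,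
    tendsto_natCast_log.eventually_ge_atTop (2 * a * Real.log 4),
    eventually_mul_one_add_log_le a (1 / 2) (by norm_num)] with L hlog hL hlog4 hsq
  have hL0 : (0 : ℝ) < L := by exact_mod_cast hL
  set lg := Real.log (L : ℝ)
  set y := a * (1 + lg) / L with hy
  have hy0 : 0 < y := by positivity
  have hlogy : Real.log y ≤ -(lg / 2) := by
    have h2 : y ≤ (L : ℝ) ^ (-(1 / 2) : ℝ) := by
      rw [hy, div_le_iff₀ hL0, ← Real.rpow_add_one hL0.ne']
      norm_num at hsq ⊢
      exact hsq
    have h3 := Real.log_le_log hy0 h2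
    rw [Real.log_rpow hL0] at h3
    linarith
  have hlogy2 : -lg ≤ Real.log y := by
    rw [← Real.log_inv]
    refine Real.log_le_log (by positivity) ?_
    rw [hy, inv_eq_one_div]
    gcongr
    nlinarith
  have hlogya : Real.log (y ^ (1 / a)) = Real.log y / a := by
    rw [Real.log_rpow hy0]; ring
  have hγ : gammaL n L = y ^ (1 / a) := by
    have e : Real.log (Real.exp 1 * L) = 1 + lg := by
      rw [Real.log_mul (Real.exp_ne_zero 1) hL0.ne', Real.log_exp]
    rw [gammaL, e]
    -- Because `y ≤ L^(-1/2)` eventually, the second argument drops below `1/4` once `log L ≥ 2a log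
    -- 4`.
    refine min_eq_right ?_
    rw [← Real.log_le_log_iff (by positivity) (by norm_num), hlogya, div_le_iff₀ (by linarith),
      one_div, Real.log_inv]
    linarith
  refine ⟨hlog, hL, hγ, ?_, ?_⟩
  · rw [hγ, log_exp_one_div (by positivity), hlogya]
    have : Real.log y / a ≤ -(lg / 2) / a := by gcongr
    have e : -(lg / 2) / a = -(lg / (2 * a)) := by field_simp
    linarith
  · rw [hγ, log_exp_one_div (by positivity), hlogya]
    have h2 : -lg / a ≤ Real.log y / a := by gcongr
    have h3 : -lg ≤ -lg / a := by
      rw [neg_div, neg_le_neg_iff]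
      exact div_le_self (by linarith) ha1
    linarith

/-- The target rate. -/
noncomputable def rate (n p L : ℕ) : ℝ :=
  Real.log (L : ℝ) ^ (((n : ℝ) - (p : ℝ)) / 2) /
    (L : ℝ) ^ (((n : ℝ) - (p : ℝ) - 1) / (2 * ((n : ℝ) - 1)))

/-- In the rate the exponent of `L` is at most 1 and the logarithmic factor is eventually at least
1, so every `O(1/L)` term is absorbed. -/
lemma inv_isBigO_rate (hn : p + 1 < n) :
    (fun L : ℕ => ((L : ℝ))⁻¹) =O[atTop] rate n p := by
  refine IsBigO.of_bound 1 ?_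
  filter_upwards [tendsto_natCast_log.eventually_ge_atTop 1, eventually_ge_atTop 1] with L hlog hL
  have hL1 : (1 : ℝ) ≤ L := by exact_mod_cast hL
  have hn1 : (p : ℝ) + 1 < n := by exact_mod_cast hn
  have hp : (0 : ℝ) ≤ p := Nat.cast_nonneg p
  have h1 : 1 ≤ Real.log (L : ℝ) ^ (((n : ℝ) - (p : ℝ)) / 2) :=
    Real.one_le_rpow hlog (by linarith)
  have h2 : (L : ℝ) ^ (((n : ℝ) - (p : ℝ) - 1) / (2 * ((n : ℝ) - 1))) ≤ L := by
    conv_rhs => rw [← Real.rpow_one (L : ℝ)]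
    refine Real.rpow_le_rpow_of_exponent_le hL1 ?_
    rw [div_le_one (by linarith)]
    linarith
  rw [one_mul, Real.norm_of_nonneg (by positivity), rate, Real.norm_of_nonneg (by positivity),
    inv_eq_one_div]
  gcongr

/-- The exponent is at most a constant minus `c (log L)²`, and `c log L ≥ 1` eventually. -/
lemma tail_isBigO_inv (hn : 2 ≤ n) {C σ : ℝ} (hC : 0 < C) (hσ : 0 < σ) :
    (fun L : ℕ => Real.exp (-((n : ℝ) / 2) * Psi (max 1
      (C * Real.log (Real.exp 1 / gammaL n L) ^ 2 / (16 * σ ^ 2))))) =O[atTop]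
        fun L : ℕ => ((L : ℝ))⁻¹ := by
  have h1 : (2 : ℝ) ≤ n := by exact_mod_cast hn
  set a : ℝ := (n : ℝ) - 1 with ha
  have ha1 : 1 ≤ a := by linarith
  set c : ℝ := (n / 4) * (C / (16 * σ ^ 2)) / (2 * a) ^ 2 with hc
  have hc0 : 0 < c := by positivity
  refine IsBigO.of_bound (Real.exp (n / 2)) ?_
  filter_upwards [eventually_gammaL hn, tendsto_natCast_log.eventually_ge_atTop (1 / c)]
    with L ⟨hlog, hL, hγ, hlow, _⟩ hlogc
  have hL0 : (0 : ℝ) < L := by exact_mod_cast hL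
  rw [Real.norm_of_nonneg (Real.exp_nonneg _), Real.norm_of_nonneg (by positivity)]
  refine (exp_neg_mul_Psi_max_le (by positivity)).trans ?_
  refine mul_le_mul_of_nonneg_left ?_ (Real.exp_nonneg _)
  rw [← Real.exp_log (inv_pos.2 hL0), Real.log_inv]
  refine Real.exp_le_exp.2 ?_
  set lg := Real.log (L : ℝ)
  set ℓ := Real.log (Real.exp 1 / gammaL n L)
  have h2 : (lg / (2 * a)) ^ 2 ≤ ℓ ^ 2 := pow_le_pow_left₀ (by positivity) hlow 2
  have h3 : c * lg ^ 2 ≤ (n : ℝ) / 2 / 2 * (C * ℓ ^ 2 / (16 * σ ^ 2)) := by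
    calc c * lg ^ 2 = (n / 4) * (C / (16 * σ ^ 2)) * (lg / (2 * a)) ^ 2 := by
          rw [hc]; field_simp
      _ ≤ (n / 4) * (C / (16 * σ ^ 2)) * ℓ ^ 2 := by gcongr
      _ = _ := by ring
  have h4 : lg ≤ c * lg ^ 2 := by
    have : 1 ≤ c * lg := by rwa [div_le_iff₀' hc0] at hlogc
    nlinarith
  linarith

/-- This is `g·log(e/g) ≤ 1` again; it makes the first tail smaller than the second. -/
lemma sharper_tail_le {C σ g : ℝ} (hC : 0 < C) (hσ : 0 < σ) (hg0 : 0 < g) (hg1 : g ≤ 1) :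
    C * Real.log (Real.exp 1 / g) ^ 2 / (16 * σ ^ 2) ≤
      C * Real.log (Real.exp 1 / g) / (2 * σ ^ 2 * g) := by
  have h1 := one_le_log_exp_one_div hg0 hg1
  have h2 := mul_log_exp_one_div_le_one hg0
  set ℓ := Real.log (Real.exp 1 / g)
  rw [div_le_div_iff₀ (by positivity) (by positivity)]
  have h3 : 0 ≤ C * ℓ * σ ^ 2 := by positivity
  nlinarith

lemma Psi_mono {x y : ℝ} (hx : 1 ≤ x) (hxy : x ≤ y) : Psi x ≤ Psi y := by
  have hx0 : 0 < x := by linarith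
  have h := Real.log_le_sub_one_of_pos (show 0 < y / x from div_pos (by linarith) hx0)
  rw [Real.log_div (by linarith) hx0.ne'] at h
  have h2 : y / x - 1 ≤ y - x := by
    rw [div_sub_one hx0.ne', div_le_iff₀ hx0]
    nlinarith
  rw [Psi, Psi]
  linarith

lemma first_tail_isBigO_inv (hn : 2 ≤ n) {C σ : ℝ} (hC : 0 < C) (hσ : 0 < σ) :
    (fun L : ℕ => Real.exp (-((n : ℝ) / 2) * Psi (max 1
      (C * Real.log (Real.exp 1 / gammaL n L) / (2 * σ ^ 2 * gammaL n L))))) =O[atTop]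
        fun L : ℕ => ((L : ℝ))⁻¹ := by
  refine IsBigO.trans (IsBigO.of_bound 1 ?_) (tail_isBigO_inv hn hC hσ)
  filter_upwards [eventually_ge_atTop 1] with L hL
  rw [one_mul, Real.norm_of_nonneg (Real.exp_nonneg _), Real.norm_of_nonneg (Real.exp_nonneg _)]
  refine Real.exp_le_exp.2 ?_
  rw [neg_mul, neg_mul, neg_le_neg_iff]
  refine mul_le_mul_of_nonneg_left ?_ (by positivity)
  exact Psi_mono (le_max_left _ _) (max_le_max le_rfl
    (sharper_tail_le hC hσ (gammaL_pos hn hL) ((gammaL_le n L).trans (by norm_num))))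

lemma cap_isBigO_rate (hn : p + 1 < n) :
    (fun L : ℕ => (gammaL n L * Real.log (Real.exp 1 / gammaL n L)) ^
      (((n : ℝ) - (p : ℝ) - 1) / 2)) =O[atTop] rate n p := by
  have hn1 : (p : ℝ) + 1 < n := by exact_mod_cast hn
  have hn2 : 2 ≤ n := by omega
  have hp : (0 : ℝ) ≤ p := Nat.cast_nonneg p
  set a : ℝ := (n : ℝ) - 1 with ha
  have ha1 : 0 < a := by linarith
  set e : ℝ := ((n : ℝ) - (p : ℝ) - 1) / 2 with he
  have he0 : 0 ≤ e := by rw [he]; linarith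
  refine IsBigO.of_bound (((2 * a) ^ (1 / a) * 2) ^ e) ?_
  filter_upwards [eventually_gammaL hn2] with L ⟨hlog, hL, hγ, _, hup⟩
  have hL0 : (0 : ℝ) < L := by exact_mod_cast hL
  have hγ0 := gammaL_pos hn2 hL
  have hℓ := one_le_log_exp_one_div hγ0 ((gammaL_le n L).trans (by norm_num))
  set lg := Real.log (L : ℝ)
  set ℓ := Real.log (Real.exp 1 / gammaL n L)
  have hlg0 : 0 < lg := by linarith
  have h1 : gammaL n L ≤ (2 * a) ^ (1 / a) * lg ^ (1 / a) / (L : ℝ) ^ (1 / a) := by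
    rw [hγ, ← Real.mul_rpow (by positivity) hlg0.le, ← Real.div_rpow (by positivity) hL0.le]
    refine Real.rpow_le_rpow (by positivity) (div_le_div_of_nonneg_right ?_ hL0.le) (by positivity)
    rw [← ha]
    nlinarith
  have h2 : gammaL n L * ℓ ≤ ((2 * a) ^ (1 / a) * 2) * (lg ^ (1 / a + 1) / (L : ℝ) ^ (1 / a)) := by
    calc gammaL n L * ℓ ≤ (2 * a) ^ (1 / a) * lg ^ (1 / a) / (L : ℝ) ^ (1 / a) * (2 * lg) := by
          gcongr
      _ = _ := by rw [Real.rpow_add_one hlg0.ne']; ring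
  rw [Real.norm_of_nonneg (by positivity), rate, Real.norm_of_nonneg (by positivity)]
  refine (Real.rpow_le_rpow (by positivity) h2 he0).trans ?_
  rw [Real.mul_rpow (by positivity) (by positivity)]
  refine mul_le_mul_of_nonneg_left ?_ (by positivity)
  rw [Real.div_rpow (by positivity) (by positivity), ← Real.rpow_mul hlg0.le,
    ← Real.rpow_mul hL0.le, show 1 / a * e = ((n : ℝ) - (p : ℝ) - 1) / (2 * a) by
      rw [he]; field_simp]
  gcongr
  rw [add_mul, one_mul, he]
  -- The logarithm occurs with exponent `(1/a + 1)e`; as `e/a ≤ 1/2`, this is at most `e + 1/2 =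
  -- (n-p)/2`.
  have : 1 / a * (((n : ℝ) - (p : ℝ) - 1) / 2) ≤ 1 / 2 := by
    rw [div_mul_div_comm, div_le_div_iff₀ (by positivity) (by norm_num)]
    linarith
  linarith

lemma miss_isBigO_inv (hn : 2 ≤ n) :
    (fun L : ℕ => (1 - gammaL n L ^ (n - 1) / ((n : ℝ) - 1)) ^ L) =O[atTop]
      fun L : ℕ => ((L : ℝ))⁻¹ := by
  have h1 : (2 : ℝ) ≤ n := by exact_mod_cast hn
  set a : ℝ := (n : ℝ) - 1 with ha
  have ha1 : 1 ≤ a := by linarith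
  refine IsBigO.of_bound 1 ?_
  filter_upwards [eventually_gammaL hn] with L ⟨hlog, hL, hγ, _, _⟩
  have hL0 : (0 : ℝ) < L := by exact_mod_cast hL
  have hγ0 := gammaL_pos hn hL
  have hγ1 : gammaL n L ^ (n - 1) ≤ 1 :=
    pow_le_one₀ hγ0.le ((gammaL_le n L).trans (by norm_num))
  have hnonneg : 0 ≤ 1 - gammaL n L ^ (n - 1) / a := by
    rw [sub_nonneg, div_le_one (by linarith)]
    linarith
  have hpow : gammaL n L ^ (n - 1) = a * (1 + Real.log L) / L := by
    have e : ((n - 1 : ℕ) : ℝ) = a := by rw [ha, Nat.cast_sub (by omega), Nat.cast_one]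
    rw [hγ, ← Real.rpow_natCast, e, ← Real.rpow_mul (by positivity), one_div,
      inv_mul_cancel₀ (by positivity), Real.rpow_one]
  rw [Real.norm_of_nonneg (pow_nonneg hnonneg L), Real.norm_of_nonneg (by positivity), one_mul]
  have h2 : 1 - gammaL n L ^ (n - 1) / a ≤ Real.exp (-(gammaL n L ^ (n - 1) / a)) := by
    have := Real.add_one_le_exp (-(gammaL n L ^ (n - 1) / a))
    linarith
  refine (pow_le_pow_left₀ hnonneg h2 L).trans ?_
  rw [← Real.exp_nat_mul, hpow, ← Real.exp_log (inv_pos.2 hL0), Real.log_inv]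
  refine Real.exp_le_exp.2 ?_
  -- The choice of `γ_L` makes the exponent exactly `-log(eL)`.
  have e : (L : ℝ) * -(a * (1 + Real.log L) / L / a) = -(1 + Real.log L) := by
    field_simp
  rw [e]
  linarith

lemma deltaL_isBigO_rate (hn : p + 1 < n) (k : ℕ) {C σ : ℝ} (hC : 0 < C) (hσ : 0 < σ) :
    (fun L : ℕ => deltaL n p k C σ L) =O[atTop] rate n p := by
  have hn2 : 2 ≤ n := by omega
  have hinv := inv_isBigO_rate hn
  simp only [deltaL, Delta]
  refine ((IsBigO.fun_sum fun m _ => ?_).add ?_).add ((miss_isBigO_inv hn2).trans hinv)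
  · exact ((first_tail_isBigO_inv hn2 hC hσ).add (tail_isBigO_inv hn2 hC hσ)).const_mul_left _
      |>.trans hinv
  · exact (cap_isBigO_rate hn).const_mul_left _

end Rates

/-! ### Coverage of the union confidence set. -/

section Coverage

variable {n p₁ p₂ k : ℕ} {X : Matrix (Fin n) (Fin p₁) ℝ} {Z : Matrix (Fin n) (Fin p₂) ℝ}
  {π₀ : Equiv.Perm (Fin n)} {β₁ : EuclideanSpace ℝ (Fin p₁)} {β₂ : EuclideanSpace ℝ (Fin p₂)}

lemma IsReproArgmin.eq_of_forall_lt {Y u : EuclideanSpace ℝ (Fin n)} {π : Equiv.Perm (Fin n)}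
    (h : IsReproArgmin k X Z Y u π) (hπ₀ : π₀ ∈ sparsePerms n k)
    (hlt : ∀ π ∈ sparsePerms n k, π ≠ π₀ →
      reproObjective X Z Y u π₀ < reproObjective X Z Y u π) : π = π₀ := by
  by_contra hne
  exact absurd (h.2 π₀ hπ₀) (not_le.2 (hlt π h.1 hne))

lemma mem_confidenceSet_of_mem {α : ℝ} {C : Set (Equiv.Perm (Fin n))}
    {Y : EuclideanSpace ℝ (Fin n)} (hC : π₀ ∈ C)
    (h : partialStat X Z Y π₀ β₁ ≤ fQuantile p₁ (n - (p₁ + p₂)) α) :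
    β₁ ∈ confidenceSet X Z α C Y := Set.mem_biUnion hC h

/-- Finite-sample coverage of the union confidence set. -/
lemma le_coverage (hπ₀ : π₀ ∈ sparsePerms n k) {σ₀ : ℝ} (hσ₀ : 0 < σ₀)
    (hrank : (expDesign X Z π₀).rank = p₁ + p₂) (hn : p₁ + p₂ + 1 < n)
    (hsep : 0 < sepConst k X Z π₀ β₁ β₂) {α : ℝ} (hα : α ∈ Set.Ioo (0 : ℝ) 1) {L : ℕ}
    (hL : 2 ≤ L) {Ω : Type*} [MeasurableSpace Ω] (P : Measure Ω) [IsProbabilityMeasure P]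
    (Ustar : Fin L → Ω → EuclideanSpace ℝ (Fin n)) (U : Ω → EuclideanSpace ℝ (Fin n))
    (hlaw : HasLaw (fun ω => (fun l => Ustar l ω, U ω))
      ((Measure.pi fun _ : Fin L => stdGaussian (EuclideanSpace ℝ (Fin n))).prod
        (stdGaussian (EuclideanSpace ℝ (Fin n)))) P)
    (πhat : Fin L → Ω → Equiv.Perm (Fin n))
    (hargmin : ∀ l ω, IsReproArgmin k X Z (response X Z π₀ β₁ β₂ σ₀ (U ω)) (Ustar l ω)
      (πhat l ω)) :
    α - deltaL n (p₁ + p₂) k (sepConst k X Z π₀ β₁ β₂) σ₀ L ≤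
      P.real {ω | β₁ ∈ confidenceSet X Z α (candidateSet k fun l => πhat l ω)
        (response X Z π₀ β₁ β₂ σ₀ (U ω))} := by
  obtain ⟨F, hF, hgood⟩ := exists_failure_set (X := X) (Z := Z) (β₁ := β₁) (β₂ := β₂) hπ₀ hn hsep
    hσ₀ (gammaL_pos (by omega) (by omega) : 0 < gammaL n L) (gammaL_le n L) L
  set Q := (Measure.pi fun _ : Fin L => stdGaussian (EuclideanSpace ℝ (Fin n))).prod
    (stdGaussian (EuclideanSpace ℝ (Fin n)))
  set f : Ω → (Fin L → EuclideanSpace ℝ (Fin n)) × EuclideanSpace ℝ (Fin n) :=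
    fun ω => (fun l => Ustar l ω, U ω) with hf
  obtain ⟨hmeas, hdist⟩ := stdGaussian_partialStat_le X Z hrank (by omega) β₁ β₂ hσ₀
    (fQuantile p₁ (n - (p₁ + p₂)) α)
  set T := {u | partialStat X Z (response X Z π₀ β₁ β₂ σ₀ u) π₀ β₁ ≤
    fQuantile p₁ (n - (p₁ + p₂)) α}
  have hT : α ≤ P.real (f ⁻¹' (Prod.snd ⁻¹' T)) := by
    have h1 : P.real (f ⁻¹' (Prod.snd ⁻¹' T)) = Q.real (Prod.snd ⁻¹' T) := by
      rw [Measure.real, Measure.real, ← hlaw.map_eq,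
        Measure.map_apply_of_aemeasurable hlaw.aemeasurable (measurable_snd hmeas)]
    have h2 : Q.real (Prod.snd ⁻¹' T) = (stdGaussian (EuclideanSpace ℝ (Fin n))).real T :=
      congrArg ENNReal.toReal (measurePreserving_snd.measure_preimage hmeas.nullMeasurableSet)
    rw [h1, h2, hdist]
    exact le_cdf_fQuantile _ _ hα
  -- This inequality holds for arbitrary sets. The minimizers need not be measurable in `ω`, so the
  -- coverage event is handled only through monotonicity and subadditivity.
  have hPF : P.real (f ⁻¹' F) ≤ Q.real F := by
    refine ENNReal.toReal_mono (measure_ne_top Q F) ?_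
    rw [← hlaw.map_eq]
    exact Measure.le_map_apply hlaw.aemeasurable F
  have hsub : f ⁻¹' (Prod.snd ⁻¹' T) ⊆
      {ω | β₁ ∈ confidenceSet X Z α (candidateSet k fun l => πhat l ω)
        (response X Z π₀ β₁ β₂ σ₀ (U ω))} ∪ f ⁻¹' F := by
    intro ω hω
    by_cases hωF : f ω ∈ F
    · exact Or.inr hωF
    · obtain ⟨l, hl⟩ := hgood _ hωF
      exact Or.inl (mem_confidenceSet_of_mem
        ⟨hπ₀, l, (hargmin l ω).eq_of_forall_lt hπ₀ hl⟩ hω)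
  have h := (measureReal_mono (μ := P) hsub).trans (measureReal_union_le _ _)
  have hδ : Q.real F ≤ deltaL n (p₁ + p₂) k (sepConst k X Z π₀ β₁ β₂) σ₀ L := hF
  linarith

end Coverage

end PartialPerm

theorem mainTheorem10 {n p₁ p₂ k : ℕ}
    (X : Matrix (Fin n) (Fin p₁) ℝ) (Z : Matrix (Fin n) (Fin p₂) ℝ)
    (π₀ : Equiv.Perm (Fin n)) (hπ₀ : π₀ ∈ sparsePerms n k)
    (β₁ : EuclideanSpace ℝ (Fin p₁)) (β₂ : EuclideanSpace ℝ (Fin p₂))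
    (σ₀ : ℝ) (hσ₀ : 0 < σ₀)
    (hrank : (expDesign X Z π₀).rank = p₁ + p₂)
    (hn : p₁ + p₂ + 1 < n)
    (hsep : 0 < sepConst k X Z π₀ β₁ β₂)
    (α : ℝ) (hα : α ∈ Set.Ioo (0 : ℝ) 1) :
    (∀ (L : ℕ), 2 ≤ L →
      ∀ (Ω : Type*) [MeasurableSpace Ω] (P : Measure Ω) [IsProbabilityMeasure P]
        (Ustar : Fin L → Ω → EuclideanSpace ℝ (Fin n)) (U : Ω → EuclideanSpace ℝ (Fin n)),
        HasLaw (fun ω => (fun l => Ustar l ω, U ω))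
          ((Measure.pi fun _ : Fin L => stdGaussian (EuclideanSpace ℝ (Fin n))).prod
            (stdGaussian (EuclideanSpace ℝ (Fin n)))) P →
        ∀ πhat : Fin L → Ω → Equiv.Perm (Fin n),
          (∀ l ω, IsReproArgmin k X Z (response X Z π₀ β₁ β₂ σ₀ (U ω)) (Ustar l ω) (πhat l ω)) →
          α - deltaL n (p₁ + p₂) k (sepConst k X Z π₀ β₁ β₂) σ₀ L ≤
            P.real {ω | β₁ ∈ confidenceSet X Z α (candidateSet k fun l => πhat l ω)
              (response X Z π₀ β₁ β₂ σ₀ (U ω))}) ∧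
      (fun L : ℕ => deltaL n (p₁ + p₂) k (sepConst k X Z π₀ β₁ β₂) σ₀ L) =O[atTop]
        fun L : ℕ => Real.log (L : ℝ) ^ (((n : ℝ) - ((p₁ : ℝ) + (p₂ : ℝ))) / 2) /
          (L : ℝ) ^ (((n : ℝ) - ((p₁ : ℝ) + (p₂ : ℝ)) - 1) / (2 * ((n : ℝ) - 1))) := by
  refine ⟨fun L hL Ω _ P _ Ustar U hlaw πhat hargmin =>
    le_coverage hπ₀ hσ₀ hrank hn hsep hα hL P Ustar U hlaw πhat hargmin, ?_⟩
  have h := deltaL_isBigO_rate hn k hsep hσ₀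
  convert h using 2 with L
  rw [rate, Nat.cast_add]
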